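/- Let $\Omega\subset\mathbb R^2$ be a nonempty, open, connected, bounded set with Lipschitz boundary, let $m>2$ and $K\ge 1$ be integers, $\nu>0$, and let $W\colon\mathbb R^{2\times 2}\to[0,\infty]$ be lower semicontinuous. Let $\mathcal Y$ be a real Hilbert space and let $A\colon L^2(\Omega)\to\mathcal Y$ be a continuous linear operator that does not vanish on nonzero constant functions. Let $R\in L^2(\Omega)$. The set $\mathcal A$ of admissible deformations consists of all $\varphi\in (W^{m,2}(\Omega))^2$ (identified with their continuous representatives on $\overline\Omega$) such that $\det(D\varphi)>0$ a.e. in $\Omega$ and $\varphi(x)=x$ for $x\in\partial\Omega$. For $I\in L^2(\Omega)$ and $\varphi\in\mathcal A$ let $I\circ\varphi^{-1}(x)=I(y)$ if $y$ is the only point of $\overline\Omega$ with $\varphi(y)=x$, and $I\circ\varphi^{-1}(x)=0$ if there is no such point. For $u\in L^2(\Omega)$ let $$TV(u)=\sup\Big\{\int_\Omega u\,\operatorname{div}\eta\,dx:\ \eta\in C_c^\infty(\Omega;\mathbb R^2),\ |\eta|\le 1\Big\}\in[0,\infty].$$ For $\mathbf I=(I_0,\dots,I_{K-1})\in L^2(\Omega)^K$,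 $\boldsymbol\varphi=(\varphi_0,\dots,\varphi_{K-1})\in\mathcal A^K$, $\alpha>0$ and $B\in\mathcal Y$, put $I_K:=R$ and $$\mathcal J_{\alpha,B}(\mathbf I,\boldsymbol\varphi)=\tfrac12\|AI_0-B\|_{\mathcal Y}^2+\alpha\,TV(I_0)+\alpha\sum_{k=0}^{K-1}\int_\Omega W(D\varphi_k)+\nu|D^m\varphi_k|^2+\big|I_k\circ\varphi_k^{-1}-I_{k+1}\big|^2\,dx\in[0,\infty],$$ where $|D^m\varphi|^2=\sum_{i=1}^2\sum_{|a|=m}|D^a\varphi_i|^2$ (sum over multi-indices $a$). A minimizer of $\mathcal J_{\alpha,B}$ is a minimizer over $L^2(\Omega)^K\times\mathcal A^K$. Let $B\in\mathcal Y$ and suppose that there exists $(\tilde{\mathbf I},\tilde{\boldsymbol\varphi})\in L^2(\Omega)^K\times\mathcal A^K$ with $A\tilde I_0=B$ and $\mathcal J_{1,B}(\tilde{\mathbf I},\tilde{\boldsymbol\varphi})<\infty$. Let $\alpha\colon(0,\infty)\to(0,\infty)$ satisfy $\alpha(\delta)\to0$ and $\delta/\alpha(\delta)\to0$ as $\delta\to0$.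 Let $(\delta_j)_{j\in\mathbb N}$ be a sequence of positive numbers converging to $0$, let $(B_j)_{j\in\mathbb N}$ be a sequence in $\mathcal Y$ with $\|B-B_j\|_{\mathcal Y}^2\le\delta_j$ for each $j$, put $\alpha_j:=\alpha(\delta_j)$, and for each $j$ let $(\mathbf I^{(j)},\boldsymbol\varphi^{(j)})$ be a minimizer of $\mathcal J_{\alpha_j,B_j}$. Then there exists a subsequence of $(I_0^{(j)})_{j\in\mathbb N}$ that converges weakly in $L^2(\Omega)$ to an image $\hat I_0\in L^2(\Omega)$ with $A\hat I_0=B$. -/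

import Mathlib

open MeasureTheory Filter Topology
open scoped ENNReal NNReal ContDiff

namespace TDMInv

noncomputable section

/-- The Euclidean plane. -/
abbrev Plane : Type := EuclideanSpace ℝ (Fin 2)

/-- The standard unit vectors of the plane. -/
def unitVec (i : Fin 2) : Plane := EuclideanSpace.single i (1 : ℝ)

/-- The space of images, `L²(Ω)`, for Lebesgue measure on `Ω`. -/
abbrev L2 (Ω : Set Plane) : Type := Lp ℝ 2 (volume.restrict Ω)

/-- Lipschitz boundary: near each boundary point, after a linear isometry of the coordinates,
`Ω` is the set of points lying strictly above the graph of a Lipschitz function. -/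
def HasLipschitzBoundary (Ω : Set Plane) : Prop :=
  ∀ p ∈ frontier Ω, ∃ (e : Plane ≃ₗᵢ[ℝ] Plane) (γ : ℝ → ℝ) (L : ℝ≥0) (r : ℝ),
    LipschitzWith L γ ∧ 0 < r ∧ ∀ x ∈ Metric.ball p r, x ∈ Ω ↔ γ (e x 0) < e x 1

/-- Smooth functions with compact support in `Ω`, with values in `F`. -/
structure IsTest {F : Type*} [NormedAddCommGroup F] [NormedSpace ℝ F]
    (Ω : Set Plane) (η : Plane → F) : Prop where
  contDiff : ContDiff ℝ ∞ η
  hasCompactSupport : HasCompactSupport η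
  tsupport_subset : tsupport η ⊆ Ω

/-- The classical partial derivative in the `i`-th coordinate direction. -/
def partialDeriv (i : Fin 2) (f : Plane → ℝ) : Plane → ℝ :=
  fun x => fderiv ℝ f x (unitVec i)

/-- The classical derivative `∂^a f` for a multi-index `a`. -/
def multiDeriv (a : Fin 2 → ℕ) (f : Plane → ℝ) : Plane → ℝ :=
  (partialDeriv 0)^[a 0] ((partialDeriv 1)^[a 1] f)

/-- The order `|a|` of a multi-index. -/
def order (a : Fin 2 → ℕ) : ℕ := ∑ i, a i

/-- `g` is a weak derivative `D^a f` of `f` on `Ω`. -/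
structure HasWeakDeriv (Ω : Set Plane) (a : Fin 2 → ℕ) (f g : Plane → ℝ) : Prop where
  locallyIntegrableOn_left : LocallyIntegrableOn f Ω volume
  locallyIntegrableOn_right : LocallyIntegrableOn g Ω volume
  integral_eq : ∀ η : Plane → ℝ, IsTest Ω η →
    ∫ x in Ω, f x * multiDeriv a η x = (-1 : ℝ) ^ order a * ∫ x in Ω, g x * η x

open Classical in
/-- The weak derivative `D^a f` on `Ω` (unique almost everywhere on `Ω`; zero if there is none). -/
def weakDeriv (Ω : Set Plane) (a : Fin 2 → ℕ) (f : Plane → ℝ) : Plane → ℝ :=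
  if h : ∃ g, HasWeakDeriv Ω a f g then h.choose else 0

/-- The Sobolev space `W^{m,2}(Ω)`: all weak derivatives up to order `m` exist and lie
in `L²(Ω)` (the multi-index `0` gives `f ∈ L²(Ω)`). -/
def MemSobolev (m : ℕ) (Ω : Set Plane) (f : Plane → ℝ) : Prop :=
  ∀ a : Fin 2 → ℕ, order a ≤ m →
    ∃ g : Plane → ℝ, MemLp g 2 (volume.restrict Ω) ∧ HasWeakDeriv Ω a f g

/-- The weak Jacobian matrix `Dφ`, with entries `∂_j φ_i`. -/
def weakJacobian (Ω : Set Plane) (φ : Plane → Plane) (x : Plane) : Matrix (Fin 2) (Fin 2) ℝ :=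
  Matrix.of fun i j => weakDeriv Ω (Pi.single j 1) (fun y => φ y i) x

/-- `|D^m φ|² = ∑_i ∑_{|a| = m} |D^a φ_i|²`. -/
def sqNormDeriv (m : ℕ) (Ω : Set Plane) (φ : Plane → Plane) (x : Plane) : ℝ :=
  ∑ i : Fin 2, ∑ a ∈ Finset.piAntidiag (Finset.univ : Finset (Fin 2)) m,
    (weakDeriv Ω a (fun y => φ y i) x) ^ 2

/-- The admissible deformations. For `m > 2` every element of `W^{m,2}(Ω)²` has exactly one
continuous representative on `closure Ω`; `φ` is that representative, so that its boundary
values are its pointwise values. The values of `φ` outside `closure Ω` play no role. -/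
structure IsAdmissible (m : ℕ) (Ω : Set Plane) (φ : Plane → Plane) : Prop where
  continuousOn : ContinuousOn φ (closure Ω)
  memSobolev : ∀ i, MemSobolev m Ω (fun x => φ x i)
  det_pos : ∀ᵐ x ∂(volume.restrict Ω), 0 < (weakJacobian Ω φ x).det
  eq_on_frontier : ∀ x ∈ frontier Ω, φ x = x

open Classical in
/-- The deformed image `I ∘ φ⁻¹`: its value at `x` is `I y` if `y` is the only point
of `closure Ω` with `φ y = x`, and `0` if there is no such point or more than one. -/
def deformed (Ω : Set Plane) (φ : Plane → Plane) (I : Plane → ℝ) (x : Plane) : ℝ :=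
  if h : ∃! y, y ∈ closure Ω ∧ φ y = x then I h.choose else 0

/-- The divergence of a vector field. -/
def divergence (η : Plane → Plane) (x : Plane) : ℝ :=
  ∑ i, fderiv ℝ η x (unitVec i) i

/-- The total variation of `u` on `Ω`, possibly infinite. -/
def totalVariation (Ω : Set Plane) (u : Plane → ℝ) : ℝ≥0∞ :=
  ⨆ (η : Plane → Plane) (_ : IsTest Ω η) (_ : ∀ x, ‖η x‖ ≤ 1),
    ENNReal.ofReal (∫ x in Ω, u x * divergence η x)

/-- The time discrete path energy
`F(I, φ) = ∑_{k<K} ∫_Ω W(Dφ_k) + ν |D^m φ_k|² + |I_k ∘ φ_k⁻¹ - I_{k+1}|² dx`, with `I_K = R`. -/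
def pathEnergy (Ω : Set Plane) (m : ℕ) (W : Matrix (Fin 2) (Fin 2) ℝ → ℝ≥0∞) (ν : ℝ)
    (R : L2 Ω) {K : ℕ} (I : Fin K → L2 Ω) (φ : Fin K → Plane → Plane) : ℝ≥0∞ :=
  ∑ k : Fin K, ∫⁻ x in Ω,
    (W (weakJacobian Ω (φ k) x) + ENNReal.ofReal (ν * sqNormDeriv m Ω (φ k) x)
      + ENNReal.ofReal
          ((deformed Ω (φ k) (I k) x
            - (Fin.snoc (α := fun _ => L2 Ω) I R k.succ : L2 Ω) x) ^ 2))

/-- The reconstruction energy `E(u; B) = ½ ‖A u - B‖² + α TV(u)`. -/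
def dataEnergy {Y : Type*} [NormedAddCommGroup Y] [InnerProductSpace ℝ Y] (Ω : Set Plane)
    (A : L2 Ω →L[ℝ] Y) (α : ℝ) (B : Y) (u : L2 Ω) : ℝ≥0∞ :=
  ENNReal.ofReal (1 / 2 * ‖A u - B‖ ^ 2) + ENNReal.ofReal α * totalVariation Ω u

/-- The functional `J(I, φ) = E(I_0; B) + β F(I, φ)` with `I_K = R`. -/
def energy {Y : Type*} [NormedAddCommGroup Y] [InnerProductSpace ℝ Y] (Ω : Set Plane)
    (m : ℕ) (W : Matrix (Fin 2) (Fin 2) ℝ → ℝ≥0∞) (ν : ℝ) (A : L2 Ω →L[ℝ] Y) (R : L2 Ω)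
    (α β : ℝ) (B : Y) {K : ℕ} [NeZero K] (I : Fin K → L2 Ω) (φ : Fin K → Plane → Plane) : ℝ≥0∞ :=
  dataEnergy Ω A α B (I 0) + ENNReal.ofReal β * pathEnergy Ω m W ν R I φ

/-- `(I, φ)` minimizes `J` over all image sequences and all sequences of admissible
deformations. -/
def IsMinimizer {Y : Type*} [NormedAddCommGroup Y] [InnerProductSpace ℝ Y] (Ω : Set Plane)
    (m : ℕ) (W : Matrix (Fin 2) (Fin 2) ℝ → ℝ≥0∞) (ν : ℝ) (A : L2 Ω →L[ℝ] Y) (R : L2 Ω)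
    (α β : ℝ) (B : Y) {K : ℕ} [NeZero K] (I : Fin K → L2 Ω) (φ : Fin K → Plane → Plane) : Prop :=
  (∀ k, IsAdmissible m Ω (φ k)) ∧
    ∀ (I' : Fin K → L2 Ω) (φ' : Fin K → Plane → Plane), (∀ k, IsAdmissible m Ω (φ' k)) →
      energy Ω m W ν A R α β B I φ ≤ energy Ω m W ν A R α β B I' φ'

end

end TDMInv

/-!
The data fidelity and the total variation of a minimizer are bounded by the energy of the exact
solution `(I', φ')`: since `A I'₀ = B`, the energy of `(I', φ')` for the perturbed data is at most
`δ / 2 + α C`, where `C` does not depend on `δ`. So `A I₀ - B → 0`, while `TV (I₀) ≤ δ / (2 α) + C` stays bounded. It remains to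
bound `I₀` in `L²(Ω)`; a weakly convergent subsequence then exists, and its limit `u` satisfies
`A u = B` by uniqueness of weak limits.

The bound rests on the Poincaré inequality `‖u - c‖_{L²(Ω)} ≤ C TV(u)` for bounded connected
Lipschitz domains in the plane, with the critical exponent (`HasLipschitzBoundary.hasPoincare`).
Once it is known, `A u = A (u - c) + c A 1` and `A 1 ≠ 0` bound the constant `c`
(`exists_norm_le_of_totalVariation_le`).

The Poincaré inequality is used in the form `∫∫ |u x - u y|² ≤ C TV(u)²`, and proved as follows.
* Every point of `closure Ω` has an affine chart along two directions pointing into `Ω`, in which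
  `Ω` is a corner region, that is, a subset of the unit square which is closed under increasing the
  coordinates and contains the points with a coordinate greater than `1/2`
  (`HasLipschitzBoundary.exists_isCornerChart`).
* On a corner region and for a smooth function, `|u x - u y|` is bounded by a quantity that only
  depends on the first coordinates of `x` and `y`, and by one that only depends on the second ones,
  both given by line integrals of partial derivatives. The product of these bounds is integrated by
  Fubini's theorem (`IsCornerRegion.lintegral_enorm_sub_sq_le`).
* Mollification extends this to functions of bounded variation, first on translates of the region
  into `Ω` and then, by Fatou's lemma, on the region itself (`IsCornerChart.hasPoincare`).
* The inequality passes to unions of two open sets that meet, thus to `Ω`, by compactness of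
  `closure Ω` and connectedness of `Ω` (`HasPoincare.of_finset_cover`).
-/

namespace TDMInv

open scoped Convolution

/-! ### The Poincaré inequality for smooth functions on corner regions -/

/-- `S` is, inside the open unit square, an open set closed under increasing either coordinate, and
it contains the part of the square where one of the coordinates exceeds `1/2`. This is the shape
of a Lipschitz domain near a boundary point, in coordinates along two directions pointing inwards. -/
structure IsCornerRegion (S : Set (ℝ × ℝ)) : Prop where
  isOpen : IsOpen S
  subset : S ⊆ Set.Ioo 0 1 ×ˢ Set.Ioo 0 1
  mono_fst : ∀ {s s' t : ℝ}, (s, t) ∈ S → s ≤ s' → s' < 1 → (s', t) ∈ S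
  mono_snd : ∀ {s t t' : ℝ}, (s, t) ∈ S → t ≤ t' → t' < 1 → (s, t') ∈ S
  strip_fst : ∀ {s t : ℝ}, s ∈ Set.Ioo (1 / 2) 1 → t ∈ Set.Ioo 0 1 → (s, t) ∈ S
  strip_snd : ∀ {s t : ℝ}, s ∈ Set.Ioo 0 1 → t ∈ Set.Ioo (1 / 2) 1 → (s, t) ∈ S

lemma IsCornerRegion.swap {S : Set (ℝ × ℝ)} (hS : IsCornerRegion S) :
    IsCornerRegion (Prod.swap ⁻¹' S) where
  isOpen := hS.isOpen.preimage continuous_swap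
  subset := fun _ hx => ⟨(hS.subset hx).2, (hS.subset hx).1⟩
  mono_fst := fun h h1 h2 => hS.mono_snd h h1 h2
  mono_snd := fun h h1 h2 => hS.mono_fst h h1 h2
  strip_fst := fun h1 h2 => hS.strip_snd h2 h1
  strip_snd := fun h1 h2 => hS.strip_fst h2 h1

lemma enorm_sub_le_lintegral_deriv {f f' : ℝ → ℝ} (hf : ∀ x, HasDerivAt f (f' x) x)
    (hc : Continuous f') {s : Set ℝ} (hs : s.OrdConnected) {a b : ℝ} (ha : a ∈ s) (hb : b ∈ s) :
    ‖f a - f b‖ₑ ≤ ∫⁻ x in s, ‖f' x‖ₑ := by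
  wlog hab : b ≤ a generalizing a b
  · rw [enorm_sub_rev]; exact this hb ha (le_of_not_ge hab)
  rw [← intervalIntegral.integral_eq_sub_of_hasDerivAt (fun x _ => hf x)
    (hc.intervalIntegrable b a), intervalIntegral.integral_of_le hab]
  refine (enorm_integral_le_lintegral_enorm _).trans (lintegral_mono_set ?_)
  exact Set.Ioc_subset_Icc_self.trans (hs.out hb ha)

/-- Two points of a corner region are joined by a horizontal, a vertical and a horizontal segment,
whose vertical part may be placed at any abscissa in `(1/2, 1)`; averaging over that abscissa bounds
the difference of the values by line integrals over the two horizontal lines and an area integral. -/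
lemma IsCornerRegion.enorm_sub_le {S : Set (ℝ × ℝ)} (hS : IsCornerRegion S)
    {w w₁ w₂ : ℝ × ℝ → ℝ} (hw₁ : ∀ s t, HasDerivAt (fun s => w (s, t)) (w₁ (s, t)) s)
    (hw₂ : ∀ s t, HasDerivAt (fun t => w (s, t)) (w₂ (s, t)) t)
    (hc₁ : Continuous w₁) (hc₂ : Continuous w₂) {x y : ℝ × ℝ} (hx : x ∈ S) (hy : y ∈ S) :
    ‖w x - w y‖ₑ ≤ (∫⁻ s in {s | (s, x.2) ∈ S}, ‖w₁ (s, x.2)‖ₑ)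
      + (∫⁻ s in {s | (s, y.2) ∈ S}, ‖w₁ (s, y.2)‖ₑ)
      + 2 * ∫⁻ z in S, ‖w₂ z‖ₑ := by
  have hcol : ∀ t, ({s | (s, t) ∈ S} : Set ℝ).OrdConnected := fun t =>
    ⟨fun a ha b hb c hc => hS.mono_fst ha hc.1 (hc.2.trans_lt (hS.subset hb).1.2)⟩
  have hrow : ∀ s, ({t | (s, t) ∈ S} : Set ℝ).OrdConnected := fun s =>
    ⟨fun a ha b hb c hc => hS.mono_snd ha hc.1 (hc.2.trans_lt (hS.subset hb).2.2)⟩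
  set g : ℝ → ℝ≥0∞ := fun t => ∫⁻ s in {s | (s, t) ∈ S}, ‖w₁ (s, t)‖ₑ with hg
  have key : ∀ r ∈ Set.Ioo (1 / 2 : ℝ) 1,
      ‖w x - w y‖ₑ ≤ g x.2 + g y.2 + ∫⁻ t in {t | (r, t) ∈ S}, ‖w₂ (r, t)‖ₑ := by
    intro r hr
    have h1 := hS.strip_fst hr (hS.subset hx).2
    have h2 := hS.strip_fst hr (hS.subset hy).2
    have e1 : ‖w x - w (r, x.2)‖ₑ ≤ g x.2 :=
      enorm_sub_le_lintegral_deriv (f := fun s => w (s, x.2)) (fun s => hw₁ s x.2)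
        (hc₁.comp (by fun_prop)) (hcol _) (a := x.1) hx h1
    have e2 : ‖w (r, y.2) - w y‖ₑ ≤ g y.2 :=
      enorm_sub_le_lintegral_deriv (f := fun s => w (s, y.2)) (fun s => hw₁ s y.2)
        (hc₁.comp (by fun_prop)) (hcol _) (b := y.1) h2 hy
    have e3 : ‖w (r, x.2) - w (r, y.2)‖ₑ ≤ ∫⁻ t in {t | (r, t) ∈ S}, ‖w₂ (r, t)‖ₑ :=
      enorm_sub_le_lintegral_deriv (f := fun t => w (r, t)) (fun t => hw₂ r t)
        (hc₂.comp (by fun_prop)) (hrow _) h1 h2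
    calc ‖w x - w y‖ₑ
        = ‖(w x - w (r, x.2)) + (w (r, y.2) - w y) + (w (r, x.2) - w (r, y.2))‖ₑ := by
          congr 1; ring
      _ ≤ _ := (enorm_add_le _ _).trans (add_le_add ((enorm_add_le _ _).trans
          (add_le_add e1 e2)) e3)
  have hSm := hS.isOpen.measurableSet
  have hF : ∫⁻ r in Set.Ioo (1 / 2 : ℝ) 1, ∫⁻ t in {t | (r, t) ∈ S}, ‖w₂ (r, t)‖ₑ
      ≤ ∫⁻ z in S, ‖w₂ z‖ₑ := by
    rw [← lintegral_indicator hSm, Measure.volume_eq_prod,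
      lintegral_prod _ ((hc₂.enorm.measurable.indicator hSm).aemeasurable)]
    refine (setLIntegral_le_lintegral _ _).trans (lintegral_mono fun r => ?_)
    exact (lintegral_indicator (measurable_prodMk_left hSm) fun t => ‖w₂ (r, t)‖ₑ).ge
  have hvol : volume (Set.Ioo (1 / 2 : ℝ) 1) = 2⁻¹ := by
    rw [Real.volume_Ioo, show (1 : ℝ) - 1 / 2 = (2 : ℝ)⁻¹ by norm_num,
      ENNReal.ofReal_inv_of_pos two_pos]
    simp
  have havg := setLIntegral_mono' (μ := volume) measurableSet_Ioo key
  rw [lintegral_const, lintegral_add_left measurable_const, lintegral_const] at havg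
  simp only [Measure.restrict_apply_univ, hvol] at havg
  have h22 : (2⁻¹ : ℝ≥0∞) * 2 = 1 := ENNReal.inv_mul_cancel two_ne_zero ENNReal.ofNat_ne_top
  have := mul_le_mul_left (havg.trans (add_le_add_right hF _)) 2
  rw [mul_assoc, h22, mul_one, add_mul, mul_assoc, h22, mul_one] at this
  rwa [mul_comm 2]

lemma lintegral_section_eq {S : Set (ℝ × ℝ)} (hS : MeasurableSet S) {h : ℝ × ℝ → ℝ≥0∞}
    (hh : Measurable h) :
    ∫⁻ t, ∫⁻ s in {s | (s, t) ∈ S}, h (s, t) = ∫⁻ z in S, h z := by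
  rw [← lintegral_indicator hS, Measure.volume_eq_prod,
    lintegral_prod_symm _ (hh.indicator hS).aemeasurable]
  refine lintegral_congr fun t => ?_
  exact (lintegral_indicator (measurable_prodMk_right hS) fun s => h (s, t)).symm

lemma measurable_lintegral_section {S : Set (ℝ × ℝ)} (hS : MeasurableSet S) {h : ℝ × ℝ → ℝ≥0∞}
    (hh : Measurable h) : Measurable fun t => ∫⁻ s in {s | (s, t) ∈ S}, h (s, t) := by
  have : (fun t => ∫⁻ s in {s | (s, t) ∈ S}, h (s, t))
      = fun t => ∫⁻ s, S.indicator h (s, t) := by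
    funext t
    exact (lintegral_indicator (measurable_prodMk_right hS) fun s => h (s, t)).symm
  rw [this]
  exact (hh.indicator hS).lintegral_prod_left'

/-- The Poincaré inequality with the critical exponent on a corner region, for smooth functions:
the two bounds for `|w x - w y|`, by quantities depending on the ordinates only and on the abscissas
only, are multiplied and integrated, as in Gagliardo's proof of the Sobolev inequality. -/
lemma IsCornerRegion.lintegral_enorm_sub_sq_le {S : Set (ℝ × ℝ)} (hS : IsCornerRegion S)
    {w w₁ w₂ : ℝ × ℝ → ℝ} (hw₁ : ∀ s t, HasDerivAt (fun s => w (s, t)) (w₁ (s, t)) s)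
    (hw₂ : ∀ s t, HasDerivAt (fun t => w (s, t)) (w₂ (s, t)) t)
    (hc₁ : Continuous w₁) (hc₂ : Continuous w₂) :
    ∫⁻ x in S, ∫⁻ y in S, ‖w x - w y‖ₑ ^ 2
      ≤ 4 * ((∫⁻ z in S, ‖w₁ z‖ₑ) + ∫⁻ z in S, ‖w₂ z‖ₑ) ^ 2 := by
  have hSm := hS.isOpen.measurableSet
  have hTm := hS.swap.isOpen.measurableSet
  set G := ∫⁻ z in S, ‖w₁ z‖ₑ with hG
  set F := ∫⁻ z in S, ‖w₂ z‖ₑ with hF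
  set g : ℝ → ℝ≥0∞ := fun t => ∫⁻ s in {s | (s, t) ∈ S}, ‖w₁ (s, t)‖ₑ with hg
  set f : ℝ → ℝ≥0∞ := fun s => ∫⁻ t in {t | (s, t) ∈ S}, ‖w₂ (s, t)‖ₑ with hf
  have hgm : Measurable g := measurable_lintegral_section hSm hc₁.enorm.measurable
  have hfm : Measurable f := measurable_lintegral_section (S := Prod.swap ⁻¹' S)
    (h := fun z => ‖w₂ z.swap‖ₑ) hTm (hc₂.comp continuous_swap).enorm.measurable
  have hgi : ∫⁻ t, g t = G := lintegral_section_eq hSm hc₁.enorm.measurable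
  have hswap : ∀ h : ℝ × ℝ → ℝ≥0∞, ∫⁻ z in Prod.swap ⁻¹' S, h z.swap = ∫⁻ z in S, h z := by
    intro h
    exact Measure.measurePreserving_swap.setLIntegral_comp_preimage_emb
      MeasurableEquiv.prodComm.measurableEmbedding h S
  have hfi : ∫⁻ s, f s = F := by
    rw [hF, ← hswap]
    exact lintegral_section_eq hTm (h := fun z => ‖w₂ z.swap‖ₑ)
      (hc₂.comp continuous_swap).enorm.measurable
  have b1 : ∀ x ∈ S, ∀ y ∈ S, ‖w x - w y‖ₑ ≤ g x.2 + g y.2 + 2 * F := fun x hx y hy =>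
    hS.enorm_sub_le hw₁ hw₂ hc₁ hc₂ hx hy
  have b2 : ∀ x ∈ S, ∀ y ∈ S, ‖w x - w y‖ₑ ≤ f x.1 + f y.1 + 2 * G := by
    intro x hx y hy
    have := hS.swap.enorm_sub_le (w := w ∘ Prod.swap) (w₁ := w₂ ∘ Prod.swap)
      (w₂ := w₁ ∘ Prod.swap) (fun s t => hw₂ t s) (fun s t => hw₁ t s)
      (hc₂.comp continuous_swap) (hc₁.comp continuous_swap) (x := x.swap) (y := y.swap) hx hy
    rw [show ∫⁻ z in Prod.swap ⁻¹' S, ‖(w₁ ∘ Prod.swap) z‖ₑ = G from hswap fun z => ‖w₁ z‖ₑ] at this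
    exact this
  set J : Set ℝ := Set.Ioo 0 1
  have hJ : volume J = 1 := by simp [J]
  have hprod : (volume : Measure (ℝ × ℝ)).restrict (J ×ˢ J)
      = (volume.restrict J).prod (volume.restrict J) := by
    rw [Measure.volume_eq_prod, Measure.prod_restrict]
  have hle : ∀ {h : ℝ → ℝ≥0∞}, ∫⁻ t in J, h t ≤ ∫⁻ t, h t := setLIntegral_le_lintegral _ _
  -- the mean over the unit square of a product of functions of the two coordinates
  have hsep : ∀ a b c d : ℝ≥0∞, ∫⁻ y in J ×ˢ J, (a + g y.2 + b) * (c + f y.1 + d)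
      ≤ (a + G + b) * (c + F + d) := by
    intro a b c d
    have hm : Measurable fun t => a + g t + b := (measurable_const.add hgm).add measurable_const
    have hm' : Measurable fun t => c + f t + d := (measurable_const.add hfm).add measurable_const
    rw [hprod]
    simp_rw [mul_comm (a + g _ + b)]
    rw [lintegral_prod_mul hm'.aemeasurable hm.aemeasurable, mul_comm]
    have e1 : ∫⁻ t in J, (a + g t + b) ≤ a + G + b := by
      rw [lintegral_add_right _ measurable_const, lintegral_add_right _ hgm, lintegral_const,
        lintegral_const, Measure.restrict_apply_univ, hJ, mul_one, mul_one]
      gcongr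
      exact hle.trans hgi.le
    have e2 : ∫⁻ t in J, (c + f t + d) ≤ c + F + d := by
      rw [lintegral_add_right _ measurable_const, lintegral_add_right _ hfm, lintegral_const,
        lintegral_const, Measure.restrict_apply_univ, hJ, mul_one, mul_one]
      gcongr
      exact hle.trans hfi.le
    exact mul_le_mul' e1 e2
  calc ∫⁻ x in S, ∫⁻ y in S, ‖w x - w y‖ₑ ^ 2
      ≤ ∫⁻ x in S, ∫⁻ y in S, (g x.2 + g y.2 + 2 * F) * (f x.1 + f y.1 + 2 * G) := by
        refine setLIntegral_mono' hSm fun x hx => setLIntegral_mono' hSm fun y hy => ?_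
        rw [sq]
        exact mul_le_mul' (b1 x hx y hy) (b2 x hx y hy)
    _ ≤ ∫⁻ x in J ×ˢ J, ∫⁻ y in J ×ˢ J, (g x.2 + g y.2 + 2 * F) * (f x.1 + f y.1 + 2 * G) :=
        (lintegral_mono_set hS.subset).trans
          (lintegral_mono fun x => lintegral_mono_set hS.subset)
    _ ≤ ∫⁻ x in J ×ˢ J, (G + g x.2 + 2 * F) * (F + f x.1 + 2 * G) := by
        refine lintegral_mono fun x => (hsep _ _ _ _).trans_eq ?_
        rw [add_comm (g x.2), add_comm (f x.1)]
    _ ≤ (G + G + 2 * F) * (F + F + 2 * G) := hsep _ _ _ _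
    _ = 4 * (G + F) ^ 2 := by ring

/-! ### Mollification and total variation -/

lemma fderiv_convolution_apply {ρ ψ : Plane → ℝ} (hρ : LocallyIntegrable ρ)
    (hψc : HasCompactSupport ψ) (hψ : ContDiff ℝ 1 ψ) (x e : Plane) :
    fderiv ℝ (ρ ⋆[ContinuousLinearMap.lsmul ℝ ℝ] ψ) x e
      = (ρ ⋆[ContinuousLinearMap.lsmul ℝ ℝ] fun y => fderiv ℝ ψ y e) x := by
  rw [(hψc.hasFDerivAt_convolution_right (ContinuousLinearMap.lsmul ℝ ℝ) hρ hψ x).fderiv,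
    convolution_precompR_apply _ hρ (hψc.fderiv ℝ) (hψ.continuous_fderiv one_ne_zero)]

/-- Convolution with an even kernel is symmetric for the pairing `∫ f g`. -/
lemma integral_convolution_mul_comm {ρ f ψ : Plane → ℝ} (hρ : Integrable ρ)
    (hρe : ∀ x, ρ (-x) = ρ x) (hf : Integrable f) (hψ : Continuous ψ)
    (hψc : HasCompactSupport ψ) :
    ∫ x, (ρ ⋆[ContinuousLinearMap.lsmul ℝ ℝ] f) x * ψ x
      = ∫ x, f x * (ρ ⋆[ContinuousLinearMap.lsmul ℝ ℝ] ψ) x := by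
  simp_rw [convolution_lsmul_swap, smul_eq_mul, ← integral_mul_const, ← integral_const_mul]
  rw [integral_integral_swap]
  · refine integral_congr_ae (Eventually.of_forall fun y => integral_congr_ae
      (Eventually.of_forall fun x => ?_))
    simp only
    rw [← hρe (y - x), neg_sub]
    ring
  · obtain ⟨C, hC⟩ := hψ.bounded_above_of_compact_support hψc
    have h1 := hf.convolution_integrand (ContinuousLinearMap.lsmul ℝ ℝ).flip hρ
    exact h1.mul_bdd (g := fun p : Plane × Plane => ψ p.1) (c := C)
      (hψ.comp continuous_fst).aestronglyMeasurable (Eventually.of_forall fun p => hC p.1)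

lemma abs_normed_convolution_le_one (φ : ContDiffBump (0 : Plane)) {ψ : Plane → ℝ}
    (h1 : ∀ x, |ψ x| ≤ 1) (x : Plane) :
    |(φ.normed volume ⋆[ContinuousLinearMap.lsmul ℝ ℝ] ψ) x| ≤ 1 := by
  rw [convolution_lsmul, ← Real.norm_eq_abs, ← φ.integral_normed (μ := volume)]
  refine norm_integral_le_of_norm_le φ.integrable_normed (Eventually.of_forall fun t => ?_)
  rw [norm_smul, Real.norm_of_nonneg (φ.nonneg_normed t)]
  exact mul_le_of_le_one_right (φ.nonneg_normed t) (h1 _)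

/-- Mollification preserves test functions, if their support is far enough from the boundary. -/
lemma isTest_normed_convolution {Ω : Set Plane} (φ : ContDiffBump (0 : Plane)) {ψ : Plane → ℝ}
    (hψ : ContDiff ℝ ∞ ψ) (hψc : HasCompactSupport ψ)
    (hsub : Metric.cthickening φ.rOut (tsupport ψ) ⊆ Ω) :
    IsTest Ω (φ.normed volume ⋆[ContinuousLinearMap.lsmul ℝ ℝ] ψ) where
  contDiff := hψc.contDiff_convolution_right _ φ.integrable_normed.locallyIntegrable hψ
  hasCompactSupport := φ.hasCompactSupport_normed.convolution _ hψc
  tsupport_subset := by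
    refine (closure_minimal ?_ Metric.isClosed_cthickening).trans hsub
    refine (support_convolution_subset_swap _).trans ?_
    rintro _ ⟨a, ha, b, hb, rfl⟩
    rw [φ.support_normed_eq, mem_ball_zero_iff] at hb
    exact Metric.mem_cthickening_of_dist_le _ a _ _ (subset_tsupport _ ha)
      (by simpa using hb.le)

lemma ofReal_integral_mul_fderiv_le {Ω : Set Plane} (u : Plane → ℝ) {ζ : Plane → ℝ}
    (hζ : IsTest Ω ζ) (h1 : ∀ x, |ζ x| ≤ 1) (e : Plane) :
    ENNReal.ofReal (∫ x in Ω, u x * fderiv ℝ ζ x e) ≤ ‖e‖ₑ * totalVariation Ω u := by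
  rcases eq_or_ne e 0 with rfl | he
  · simp
  have hne : ‖e‖ ≠ 0 := norm_ne_zero_iff.2 he
  set d : Plane := ‖e‖⁻¹ • e with hd
  have hd1 : ‖d‖ = 1 := by rw [hd, norm_smul, norm_inv, norm_norm, inv_mul_cancel₀ hne]
  have hdiff : Differentiable ℝ ζ := hζ.contDiff.differentiable (by simp)
  have hη : IsTest Ω (fun x => ζ x • d) := by
    refine ⟨hζ.contDiff.smul contDiff_const, hζ.hasCompactSupport.smul_right, ?_⟩
    refine (closure_mono fun x hx => ?_).trans hζ.tsupport_subset
    exact fun h => hx (by simp [h])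
  have hdecomp : d = ∑ i, d i • unitVec i := by
    ext j
    fin_cases j <;> simp [unitVec, Fin.sum_univ_two]
  have hdiv : ∀ x, divergence (fun x => ζ x • d) x = ‖e‖⁻¹ * fderiv ℝ ζ x e := by
    intro x
    have : fderiv ℝ (fun x => ζ x • d) x = (fderiv ℝ ζ x).smulRight d :=
      ((hdiff x).hasFDerivAt.smul_const d).fderiv
    rw [← smul_eq_mul, ← map_smul, ← hd]
    conv_rhs => rw [hdecomp]
    rw [divergence, this, map_sum]
    refine Finset.sum_congr rfl fun i _ => ?_
    simp [mul_comm]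
  have hle : ENNReal.ofReal (∫ x in Ω, u x * divergence (fun x => ζ x • d) x)
      ≤ totalVariation Ω u :=
    le_iSup₂_of_le (fun x => ζ x • d) hη (le_iSup_of_le (fun x => by
      rw [norm_smul, hd1, mul_one]; exact h1 x) le_rfl)
  calc ENNReal.ofReal (∫ x in Ω, u x * fderiv ℝ ζ x e)
      = ENNReal.ofReal (‖e‖ * ∫ x in Ω, u x * divergence (fun x => ζ x • d) x) := by
        congr 1
        rw [← integral_const_mul]
        refine integral_congr_ae (Eventually.of_forall fun x => ?_)
        simp only [hdiv]
        field_simp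
    _ = ‖e‖ₑ * ENNReal.ofReal (∫ x in Ω, u x * divergence (fun x => ζ x • d) x) := by
        rw [ENNReal.ofReal_mul (norm_nonneg e), ofReal_norm]
    _ ≤ _ := by gcongr

lemma exists_smooth_cutoff {K Ω : Set Plane} (hK : IsCompact K) (hΩ : IsOpen Ω) (hKΩ : K ⊆ Ω) :
    ∃ (K' : Set Plane) (χ : Plane → ℝ), IsCompact K' ∧ K' ⊆ Ω ∧ ContDiff ℝ ∞ χ ∧
      (∀ x ∈ K, χ x = 1) ∧ (∀ x ∉ K', χ x = 0) ∧ ∀ x, χ x ∈ Set.Icc (0 : ℝ) 1 := by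
  obtain ⟨K', hK', hKK', hK'Ω⟩ := exists_compact_between hK hΩ hKΩ
  obtain ⟨χ, h1, h0, h01⟩ := exists_contMDiffMap_one_nhds_of_subset_interior
    (n := (⊤ : ℕ∞)) (modelWithCornersSelf ℝ Plane) hK.isClosed hKK'
  exact ⟨K', χ, hK', hK'Ω, χ.contMDiff.contDiff, fun x hx => h1.self_of_nhdsSet x hx, h0, h01⟩

/-- Away from the boundary, the mollifications of `u` have directional derivatives whose `L¹` norms
are bounded by the total variation of `u`. -/
lemma exists_lintegral_fderiv_convolution_le {Ω K : Set Plane} (hΩ : IsOpen Ω) (hK : IsCompact K)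
    (hKΩ : K ⊆ Ω) : ∃ ε > 0, ∀ (u : Plane → ℝ), IntegrableOn u Ω →
      ∀ φ : ContDiffBump (0 : Plane), φ.rOut ≤ ε → ∀ e : Plane,
        ∫⁻ x in K, ‖fderiv ℝ (φ.normed volume ⋆[ContinuousLinearMap.lsmul ℝ ℝ] Ω.indicator u) x e‖ₑ
          ≤ ‖e‖ₑ * totalVariation Ω u := by
  obtain ⟨K', χ, hK', hK'Ω, hχ, hχ1, hχ0, hχ01⟩ := exists_smooth_cutoff hK hΩ hKΩ
  obtain ⟨ε, hε, hεΩ⟩ := hK'.exists_cthickening_subset_open hΩ hK'Ω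
  refine ⟨ε, hε, fun u hu φ hφ e => ?_⟩
  have hf : Integrable (Ω.indicator u) := (integrable_indicator_iff hΩ.measurableSet).2 hu
  set v := φ.normed volume ⋆[ContinuousLinearMap.lsmul ℝ ℝ] Ω.indicator u with hvdef
  have hv : ContDiff ℝ ∞ v := φ.hasCompactSupport_normed.contDiff_convolution_left _
    φ.contDiff_normed hf.locallyIntegrable
  set h : Plane → ℝ := fun x => fderiv ℝ v x e with hh
  have hhs : ContDiff ℝ ∞ h := (hv.fderiv_right (m := (⊤ : ℕ∞)) (by simp)).clm_apply contDiff_const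
  -- the test function `χ h / √(h² + κ²)` is a smooth substitute for the sign of `h`
  have main : ∀ κ : ℝ, 0 < κ → ∫⁻ x in K, ‖h x‖ₑ
      ≤ ‖e‖ₑ * totalVariation Ω u + ENNReal.ofReal (κ * volume.real K') := by
    intro κ hκ
    set ψ : Plane → ℝ := fun x => χ x * (h x / √(h x ^ 2 + κ ^ 2)) with hψ
    have hpos : ∀ x, 0 < h x ^ 2 + κ ^ 2 := fun x => by positivity
    have hψs : ContDiff ℝ ∞ ψ := hχ.mul (hhs.div (((hhs.pow 2).add contDiff_const).sqrt
      fun x => (hpos x).ne') fun x => (Real.sqrt_pos.2 (hpos x)).ne')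
    have hψ0 : ∀ x ∉ K', ψ x = 0 := fun x hx => by simp [hψ, hχ0 x hx]
    have hψc : HasCompactSupport ψ := HasCompactSupport.intro hK' hψ0
    have hψt : tsupport ψ ⊆ K' := closure_minimal
      (fun x hx => by_contra fun hx' => hx (hψ0 x hx')) hK'.isClosed
    have habs : ∀ x, |h x| ≤ √(h x ^ 2 + κ ^ 2) := fun x =>
      Real.abs_le_sqrt (by nlinarith [sq_nonneg κ])
    have hψ1 : ∀ x, |ψ x| ≤ 1 := by
      intro x
      rw [hψ, abs_mul, abs_div, abs_of_nonneg (hχ01 x).1, abs_of_pos (Real.sqrt_pos.2 (hpos x))]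
      exact mul_le_one₀ (hχ01 x).2 (by positivity)
        ((div_le_one (Real.sqrt_pos.2 (hpos x))).2 (habs x))
    have htest := isTest_normed_convolution (Ω := Ω) φ hψs hψc
      ((Metric.cthickening_mono hφ _).trans
        ((Metric.cthickening_subset_of_subset ε hψt).trans hεΩ))
    have htest' : IsTest Ω (-(φ.normed volume ⋆[ContinuousLinearMap.lsmul ℝ ℝ] ψ)) :=
      ⟨htest.contDiff.neg, htest.hasCompactSupport.neg, by
        rw [tsupport, Function.support_neg]; exact htest.tsupport_subset⟩
    have hTV := ofReal_integral_mul_fderiv_le u htest' (fun x => by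
      rw [Pi.neg_apply, abs_neg]; exact abs_normed_convolution_le_one φ hψ1 x) e
    have hψ' : Continuous fun y => fderiv ℝ ψ y e :=
      (hψs.continuous_fderiv (by simp)).clm_apply continuous_const
    have hψ'c : HasCompactSupport fun y => fderiv ℝ ψ y e := hψc.fderiv_apply ℝ e
    have hIBP : ∫ x, v x * fderiv ℝ ψ x e = - ∫ x, h x * ψ x :=
      integral_mul_fderiv_eq_neg_fderiv_mul_of_integrable
        ((hhs.continuous.mul hψs.continuous).integrable_of_hasCompactSupport hψc.mul_left)
        ((hv.continuous.mul hψ').integrable_of_hasCompactSupport hψ'c.mul_left)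
        ((hv.continuous.mul hψs.continuous).integrable_of_hasCompactSupport hψc.mul_left)
        (fun x _ => hv.differentiable (by simp) x) (fun x _ => hψs.differentiable (by simp) x)
    have heq : ∫ x in Ω, u x * fderiv ℝ (-(φ.normed volume ⋆[ContinuousLinearMap.lsmul ℝ ℝ] ψ)) x e
        = ∫ x, h x * ψ x := by
      have e1 : ∀ x, fderiv ℝ (-(φ.normed volume ⋆[ContinuousLinearMap.lsmul ℝ ℝ] ψ)) x e
          = - (φ.normed volume ⋆[ContinuousLinearMap.lsmul ℝ ℝ] fun y => fderiv ℝ ψ y e) x := by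
        intro x
        rw [fderiv_neg, neg_apply,
          fderiv_convolution_apply φ.integrable_normed.locallyIntegrable hψc
            (hψs.of_le (by simp)) x e]
      simp_rw [e1, mul_neg]
      rw [integral_neg, ← integral_indicator hΩ.measurableSet]
      simp_rw [Set.indicator_mul_left]
      rw [← integral_convolution_mul_comm φ.integrable_normed (fun x => φ.normed_neg x) hf hψ'
        hψ'c, hIBP, neg_neg]
    rw [heq] at hTV
    have hKfin : volume K' ≠ ⊤ := hK'.measure_lt_top.ne
    have hhK : IntegrableOn h K := hhs.continuous.continuousOn.integrableOn_compact hK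
    have hreal : ∫ x in K, ‖h x‖ ≤ (∫ x, h x * ψ x) + κ * volume.real K' := by
      have i1 : Integrable fun x => h x * ψ x :=
        (hhs.continuous.mul hψs.continuous).integrable_of_hasCompactSupport hψc.mul_left
      have i2 : Integrable (K'.indicator fun _ => κ) :=
        (integrable_indicator_iff hK'.measurableSet).2 (integrableOn_const hKfin)
      have : κ * volume.real K' = ∫ x, K'.indicator (fun _ => κ) x := by
        rw [integral_indicator hK'.measurableSet, setIntegral_const, smul_eq_mul, mul_comm]
      rw [this, ← integral_add i1 i2, ← integral_indicator hK.measurableSet]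
      refine integral_mono ((integrable_indicator_iff hK.measurableSet).2 hhK.norm) (i1.add i2)
        fun x => ?_
      have hq : |h x| - κ ≤ h x * (h x / √(h x ^ 2 + κ ^ 2)) := by
        have hs := Real.sqrt_pos.2 (hpos x)
        have hs2 := Real.sq_sqrt (hpos x).le
        have hle : √(h x ^ 2 + κ ^ 2) ≤ |h x| + κ := by
          rw [Real.sqrt_le_left (by positivity), add_sq, sq_abs]
          nlinarith [abs_nonneg (h x)]
        rw [← mul_div_assoc, le_div_iff₀ hs]
        have := sq_abs (h x)
        nlinarith [habs x, abs_nonneg (h x)]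
      have hnn : 0 ≤ h x * (h x / √(h x ^ 2 + κ ^ 2)) := by
        rw [← mul_div_assoc]
        exact div_nonneg (mul_self_nonneg _) (Real.sqrt_nonneg _)
      by_cases hx : x ∈ K
      · have hx' : x ∈ K' := by_contra fun hx' => one_ne_zero ((hχ1 x hx).symm.trans (hχ0 x hx'))
        simp only [Set.indicator_of_mem hx, Set.indicator_of_mem hx', hψ, hχ1 x hx,
          Real.norm_eq_abs]
        linarith
      · simp only [Set.indicator_of_notMem hx, hψ]
        have : 0 ≤ K'.indicator (fun _ => κ) x := Set.indicator_nonneg (fun _ _ => hκ.le) x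
        have := mul_nonneg (hχ01 x).1 hnn
        linarith
    rw [← ofReal_integral_norm_eq_lintegral_enorm hhK]
    calc ENNReal.ofReal (∫ x in K, ‖h x‖)
        ≤ ENNReal.ofReal ((∫ x, h x * ψ x) + κ * volume.real K') := ENNReal.ofReal_le_ofReal hreal
      _ ≤ _ := ENNReal.ofReal_add_le.trans (add_le_add_left hTV _)
  have hlim : Tendsto (fun κ : ℝ => ‖e‖ₑ * totalVariation Ω u
      + ENNReal.ofReal (κ * volume.real K')) (𝓝[>] 0) (𝓝 (‖e‖ₑ * totalVariation Ω u)) := by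
    have : Continuous fun κ : ℝ => ‖e‖ₑ * totalVariation Ω u
      + ENNReal.ofReal (κ * volume.real K') :=
      continuous_const.add (ENNReal.continuous_ofReal.comp (continuous_mul_const _))
    simpa using (this.tendsto 0).mono_left nhdsWithin_le_nhds
  exact ge_of_tendsto hlim (eventually_mem_nhdsWithin.mono fun κ hκ => main κ hκ)

/-! ### The local Poincaré inequality -/

/-- The Poincaré inequality with critical exponent on `V`, for functions of bounded variation on
`Ω`. The deviation of `u` from constants in `L²(V)` is expressed by a double integral, which avoids
naming the constant and is well suited to monotone limits and unions of sets `V`. -/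
def HasPoincare (Ω V : Set Plane) : Prop :=
  ∃ C : ℝ≥0∞, C ≠ ⊤ ∧ ∀ u : Plane → ℝ, Measurable u → IntegrableOn u Ω →
    ∫⁻ x in V, ∫⁻ y in V, ‖u x - u y‖ₑ ^ 2 ≤ C * totalVariation Ω u ^ 2

/-- Fatou's lemma for double integrals. -/
lemma lintegral_lintegral_le_of_le_liminf {X : Type*} [MeasurableSpace X] {μ : Measure X}
    [SFinite μ] {F : X → X → ℝ≥0∞} {G : ℕ → X → X → ℝ≥0∞}
    (hG : ∀ n, Measurable (Function.uncurry (G n)))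
    (hF : ∀ᵐ x ∂μ, ∀ᵐ y ∂μ, F x y ≤ liminf (fun n => G n x y) atTop) {C : ℝ≥0∞}
    (hC : ∀ᶠ n in atTop, ∫⁻ x, ∫⁻ y, G n x y ∂μ ∂μ ≤ C) :
    ∫⁻ x, ∫⁻ y, F x y ∂μ ∂μ ≤ C := by
  calc ∫⁻ x, ∫⁻ y, F x y ∂μ ∂μ
      ≤ ∫⁻ x, liminf (fun n => ∫⁻ y, G n x y ∂μ) atTop ∂μ := by
        refine lintegral_mono_ae (hF.mono fun x hx => (lintegral_mono_ae hx).trans ?_)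
        exact lintegral_liminf_le fun n => (hG n).comp measurable_prodMk_left
    _ ≤ liminf (fun n => ∫⁻ x, ∫⁻ y, G n x y ∂μ ∂μ) atTop :=
        lintegral_liminf_le fun n => (hG n).lintegral_prod_right
    _ ≤ C := liminf_le_of_frequently_le' hC.frequently

/-- An affine bijection onto the plane transforms areas by a constant factor, which only depends on
its linear part. -/
lemma exists_setLIntegral_comp_eq (T : (ℝ × ℝ) ≃L[ℝ] Plane) : ∃ c : ℝ≥0∞, c ≠ 0 ∧ c ≠ ⊤ ∧
    ∀ (p : Plane) (S : Set (ℝ × ℝ)) (h : Plane → ℝ≥0∞),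
      ∫⁻ q in S, h (p + T q) = c * ∫⁻ x in (fun q => p + T q) '' S, h x := by
  have hH : ((volume : Measure (ℝ × ℝ)).map T).IsAddHaarMeasure := T.isAddHaarMeasure_map _
  refine ⟨Measure.addHaarScalarFactor ((volume : Measure (ℝ × ℝ)).map T) volume, ?_,
    ENNReal.coe_ne_top, fun p S h => ?_⟩
  · simpa only [ne_eq, ENNReal.coe_eq_zero] using
      (Measure.addHaarScalarFactor_pos_of_isAddHaarMeasure _ _).ne'
  · set c := Measure.addHaarScalarFactor ((volume : Measure (ℝ × ℝ)).map T) volume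
    have hmap : (volume : Measure (ℝ × ℝ)).map T = c • (volume : Measure Plane) :=
      Measure.isAddLeftInvariant_eq_smul _ _
    have hT : MeasurePreserving T volume (c • (volume : Measure Plane)) :=
      ⟨T.continuous.measurable, hmap⟩
    have hmp : MeasurePreserving (fun q => p + T q) volume (c • (volume : Measure Plane)) :=
      (measurePreserving_add_left (c • (volume : Measure Plane)) p).comp hT
    have hemb : MeasurableEmbedding fun q => p + T q :=
      (T.toHomeomorph.trans (Homeomorph.addLeft p)).measurableEmbedding
    rw [hmp.setLIntegral_comp_emb hemb, Measure.restrict_smul, lintegral_smul_measure]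
    rfl

/-- A family of mollifiers with radii tending to `0`. -/
noncomputable def mollifier (n : ℕ) : ContDiffBump (0 : Plane) where
  rIn := 1 / (n + 1) / 2
  rOut := 1 / (n + 1)
  rIn_pos := by positivity
  rIn_lt_rOut := half_lt_self (by positivity)

lemma tendsto_mollifier_rOut : Tendsto (fun n => (mollifier n).rOut) atTop (𝓝 0) :=
  tendsto_one_div_add_atTop_nhds_zero_nat

/-- The Poincaré inequality on an affine image of a corner region whose closure is contained in `Ω`,
with a constant that only depends on the linear part of the affine map. It follows from the smooth
case applied to mollifications. -/
lemma IsCornerRegion.lintegral_image_le {S : Set (ℝ × ℝ)} (hS : IsCornerRegion S) {Ω : Set Plane}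
    (hΩ : IsOpen Ω) (p : Plane) (T : (ℝ × ℝ) ≃L[ℝ] Plane)
    (hSΩ : ∀ q ∈ closure S, p + T q ∈ Ω) {u : Plane → ℝ}
    (hu : IntegrableOn u Ω) :
    ∫⁻ x in (fun q => p + T q) '' S, ∫⁻ y in (fun q => p + T q) '' S, ‖u x - u y‖ₑ ^ 2
      ≤ 4 * (‖T (1, 0)‖ₑ + ‖T (0, 1)‖ₑ) ^ 2 * totalVariation Ω u ^ 2 := by
  set Φ : ℝ × ℝ → Plane := fun q => p + T q with hΦ
  have hΦc : Continuous Φ := continuous_const.add T.continuous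
  set V := Φ '' S with hV
  set K := Φ '' closure S with hK
  have hScpt : IsCompact (closure S) := by
    refine ((isCompact_Icc (a := (0 : ℝ)) (b := 1)).prod
      (isCompact_Icc (a := (0 : ℝ)) (b := 1))).of_isClosed_subset isClosed_closure ?_
    exact closure_minimal (hS.subset.trans
      (Set.prod_mono Set.Ioo_subset_Icc_self Set.Ioo_subset_Icc_self))
      (isClosed_Icc.prod isClosed_Icc)
  have hKc : IsCompact K := hScpt.image hΦc
  have hKΩ : K ⊆ Ω := by rintro _ ⟨q, hq, rfl⟩; exact hSΩ q hq
  have hVK : V ⊆ K := Set.image_mono subset_closure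
  have hVm : MeasurableSet V :=
    ((T.toHomeomorph.trans (Homeomorph.addLeft p)).isOpenMap S hS.isOpen).measurableSet
  obtain ⟨ε, hε, hTV⟩ := exists_lintegral_fderiv_convolution_le hΩ hKc hKΩ
  obtain ⟨c, hc0, hct, hcov⟩ := exists_setLIntegral_comp_eq T
  have hf : Integrable (Ω.indicator u) := (integrable_indicator_iff hΩ.measurableSet).2 hu
  set v : ℕ → Plane → ℝ := fun n =>
    (mollifier n).normed volume ⋆[ContinuousLinearMap.lsmul ℝ ℝ] Ω.indicator u with hv
  have hvs : ∀ n, ContDiff ℝ 1 (v n) := fun n =>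
    (mollifier n).hasCompactSupport_normed.contDiff_convolution_left _
      (mollifier n).contDiff_normed hf.locallyIntegrable
  have hae : ∀ᵐ x ∂(volume.restrict V), Tendsto (fun n => v n x) atTop (𝓝 (u x)) := by
    have := ContDiffBump.ae_convolution_tendsto_right_of_locallyIntegrable (μ := volume)
      (φ := mollifier) (K := 2) tendsto_mollifier_rOut (Eventually.of_forall fun n => by
        simp only [mollifier]; linarith) hf.locallyIntegrable
    rw [ae_restrict_iff' hVm]
    filter_upwards [this] with x hx hxV
    rwa [Set.indicator_of_mem (hKΩ (hVK hxV))] at hx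
  refine lintegral_lintegral_le_of_le_liminf (μ := volume.restrict V)
    (G := fun n x y => ‖v n x - v n y‖ₑ ^ 2) (fun n => ?_) ?_ ?_
  · have := (hvs n).continuous
    have h2 : Continuous fun z : Plane × Plane => v n z.1 - v n z.2 := by fun_prop
    exact h2.measurable.enorm.pow_const 2
  · filter_upwards [hae] with x hx
    filter_upwards [hae] with y hy
    exact ((ENNReal.continuous_pow 2).tendsto _ |>.comp
      ((continuous_enorm.tendsto _).comp (hx.sub hy))).liminf_eq.ge
  · filter_upwards [tendsto_mollifier_rOut.eventually (Iic_mem_nhds hε)] with n hn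
    have hcd : Continuous (fderiv ℝ (v n)) := (hvs n).continuous_fderiv one_ne_zero
    have hdv : ∀ x, HasFDerivAt (v n) (fderiv ℝ (v n) x) x := fun x =>
      ((hvs n).differentiable one_ne_zero x).hasFDerivAt
    have hΦd : ∀ q, HasFDerivAt Φ (T : (ℝ × ℝ) →L[ℝ] Plane) q := fun q =>
      T.hasFDerivAt.const_add p
    have hw : ∀ q, HasFDerivAt (v n ∘ Φ) ((fderiv ℝ (v n) (Φ q)).comp
      (T : (ℝ × ℝ) →L[ℝ] Plane)) q := fun q => (hdv (Φ q)).comp q (hΦd q)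
    have hbound := hS.lintegral_enorm_sub_sq_le (w := v n ∘ Φ)
      (w₁ := fun q => fderiv ℝ (v n) (Φ q) (T (1, 0)))
      (w₂ := fun q => fderiv ℝ (v n) (Φ q) (T (0, 1)))
      (fun s t => HasFDerivAt.comp_hasDerivAt (l := v n ∘ Φ) (f := fun s => (s, t)) s (hw (s, t))
        ((hasDerivAt_id s).prodMk (hasDerivAt_const s t)))
      (fun s t => HasFDerivAt.comp_hasDerivAt (l := v n ∘ Φ) (f := fun t => (s, t)) t (hw (s, t))
        ((hasDerivAt_const t s).prodMk (hasDerivAt_id t)))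
      ((hcd.comp hΦc).clm_apply continuous_const) ((hcd.comp hΦc).clm_apply continuous_const)
    have hL : ∫⁻ x in S, ∫⁻ y in S, ‖(v n ∘ Φ) x - (v n ∘ Φ) y‖ₑ ^ 2
        = c ^ 2 * ∫⁻ x in V, ∫⁻ y in V, ‖v n x - v n y‖ₑ ^ 2 := by
      have e1 : ∀ x, ∫⁻ y in S, ‖(v n ∘ Φ) x - (v n ∘ Φ) y‖ₑ ^ 2
          = c * ∫⁻ y in V, ‖v n (Φ x) - v n y‖ₑ ^ 2 := fun x =>
        hcov p S fun y => ‖v n (Φ x) - v n y‖ₑ ^ 2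
      simp_rw [e1]
      rw [lintegral_const_mul' _ _ hct, hcov p S fun x => ∫⁻ y in V, ‖v n x - v n y‖ₑ ^ 2, sq,
        mul_assoc]
    have hR : ∀ e, ∫⁻ q in S, ‖fderiv ℝ (v n) (Φ q) e‖ₑ ≤ c * (‖e‖ₑ * totalVariation Ω u) := by
      intro e
      rw [hcov p S fun x => ‖fderiv ℝ (v n) x e‖ₑ]
      gcongr
      exact (lintegral_mono_set hVK).trans (hTV u hu (mollifier n) hn e)
    rw [hL] at hbound
    have hc2 : c ^ 2 ≠ 0 := pow_ne_zero _ hc0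
    have hc2t : c ^ 2 ≠ ⊤ := ENNReal.pow_ne_top hct
    rw [← ENNReal.mul_le_mul_iff_right hc2 hc2t]
    refine hbound.trans ((mul_le_mul_right (pow_le_pow_left' (add_le_add (hR _) (hR _)) 2)
      4).trans_eq ?_)
    ring

/-- An affine chart `q ↦ p + T q` in which `Ω` is, inside the square `(0, 2)²`, closed under
increasing the coordinates (starting in the unit square), and in which `Ω` contains the part of the
unit square where one of the coordinates exceeds `1/2`. The larger square leaves room for
translating the unit square into `Ω`. -/
structure IsCornerChart (Ω : Set Plane) (p : Plane) (T : (ℝ × ℝ) ≃L[ℝ] Plane) : Prop where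
  mono : ∀ {q q' : ℝ × ℝ}, q ∈ Set.Ioo (0 : ℝ) 1 ×ˢ Set.Ioo (0 : ℝ) 1 → p + T q ∈ Ω →
    q ≤ q' → q' ∈ Set.Iio (2 : ℝ) ×ˢ Set.Iio (2 : ℝ) → p + T q' ∈ Ω
  strip_fst : ∀ {s t : ℝ}, s ∈ Set.Ioo (1 / 2) 1 → t ∈ Set.Ioo 0 1 → p + T (s, t) ∈ Ω
  strip_snd : ∀ {s t : ℝ}, s ∈ Set.Ioo 0 1 → t ∈ Set.Ioo (1 / 2) 1 → p + T (s, t) ∈ Ω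

lemma IsCornerChart.isCornerRegion {Ω : Set Plane} (hΩ : IsOpen Ω) {p : Plane}
    {T : (ℝ × ℝ) ≃L[ℝ] Plane} (h : IsCornerChart Ω p T) :
    IsCornerRegion (Set.Ioo (0 : ℝ) 1 ×ˢ Set.Ioo (0 : ℝ) 1 ∩ {q | p + T q ∈ Ω}) where
  isOpen := (isOpen_Ioo.prod isOpen_Ioo).inter
    (hΩ.preimage (continuous_const.add T.continuous))
  subset := Set.inter_subset_left
  mono_fst := fun {s s' t} hq h1 h2 => ⟨⟨⟨hq.1.1.1.trans_le h1, h2⟩, hq.1.2⟩,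
    h.mono hq.1 hq.2 ⟨h1, le_rfl⟩ ⟨h2.trans one_lt_two, hq.1.2.2.trans one_lt_two⟩⟩
  mono_snd := fun {s t t'} hq h1 h2 => ⟨⟨hq.1.1, ⟨hq.1.2.1.trans_le h1, h2⟩⟩,
    h.mono hq.1 hq.2 ⟨le_rfl, h1⟩ ⟨hq.1.1.2.trans one_lt_two, h2.trans one_lt_two⟩⟩
  strip_fst := fun hs ht => ⟨⟨⟨(by norm_num : (0 : ℝ) < 1 / 2).trans hs.1, hs.2⟩, ht⟩,
    h.strip_fst hs ht⟩
  strip_snd := fun hs ht => ⟨⟨hs, ⟨(by norm_num : (0 : ℝ) < 1 / 2).trans ht.1, ht.2⟩⟩,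
    h.strip_snd hs ht⟩

/-- The Poincaré inequality near a point of the closure of `Ω`. The part `V` of `Ω` in the chart is
approximated by its translates `V + τ T (1, 1)`, whose closures are contained in `Ω`. -/
lemma IsCornerChart.hasPoincare {Ω : Set Plane} (hΩ : IsOpen Ω) {p : Plane}
    {T : (ℝ × ℝ) ≃L[ℝ] Plane} (h : IsCornerChart Ω p T) :
    HasPoincare Ω (Ω ∩ (fun q => p + T q) '' (Set.Ioo (0 : ℝ) 1 ×ˢ Set.Ioo (0 : ℝ) 1)) := by
  have hS := h.isCornerRegion hΩ
  set S := Set.Ioo (0 : ℝ) 1 ×ˢ Set.Ioo (0 : ℝ) 1 ∩ {q | p + T q ∈ Ω} with hSdef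
  have hVS : Ω ∩ (fun q => p + T q) '' (Set.Ioo (0 : ℝ) 1 ×ˢ Set.Ioo (0 : ℝ) 1)
      = (fun q => p + T q) '' S := by
    rw [Set.inter_comm, ← Set.image_inter_preimage]
    rfl
  rw [hVS]
  refine ⟨4 * (‖T (1, 0)‖ₑ + ‖T (0, 1)‖ₑ) ^ 2, by finiteness, fun u hum hu => ?_⟩
  set τ : ℕ → ℝ := fun n => 1 / ((n : ℝ) + 2) with hτ
  have hτpos : ∀ n, 0 < τ n := fun n => by positivity
  have hτ1 : ∀ n, τ n < 1 := fun n => by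
    rw [hτ, div_lt_one (by positivity)]
    linarith [(n.cast_nonneg : (0 : ℝ) ≤ n)]
  have hτ0 : Tendsto τ atTop (𝓝 0) := by
    have := (tendsto_one_div_add_atTop_nhds_zero_nat (𝕜 := ℝ)).comp (tendsto_add_atTop_nat 1)
    refine this.congr fun n => ?_
    simp only [Function.comp_apply, hτ, Nat.cast_add, Nat.cast_one]
    ring_nf
  set V : ℕ → Set Plane := fun n => (fun q => (p + τ n • T (1, 1)) + T q) '' S with hV
  have hopen : ∀ p' : Plane, IsOpen ((fun q => p' + T q) '' S) := fun p' =>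
    (T.toHomeomorph.trans (Homeomorph.addLeft p')).isOpenMap S hS.isOpen
  have hbound : ∀ n, ∫⁻ x in V n, ∫⁻ y in V n, ‖u x - u y‖ₑ ^ 2
      ≤ 4 * (‖T (1, 0)‖ₑ + ‖T (0, 1)‖ₑ) ^ 2 * totalVariation Ω u ^ 2 := by
    intro n
    refine hS.lintegral_image_le hΩ _ T (fun q hq => ?_) hu
    obtain ⟨q', hq', hd⟩ := Metric.mem_closure_iff.1 hq (τ n) (hτpos n)
    rw [Prod.dist_eq, max_lt_iff, Real.dist_eq, Real.dist_eq, abs_lt, abs_lt] at hd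
    have hq1 : q ∈ Set.Icc (0 : ℝ) 1 ×ˢ Set.Icc (0 : ℝ) 1 :=
      closure_minimal (hS.subset.trans
        (Set.prod_mono Set.Ioo_subset_Icc_self Set.Ioo_subset_Icc_self))
        (isClosed_Icc.prod isClosed_Icc) hq
    have := h.mono (q' := q + τ n • (1, 1)) hq'.1 hq'.2
      ⟨by simp; linarith [hd.1.1], by simp; linarith [hd.2.1]⟩
      ⟨by simp; linarith [hq1.1.2, hτ1 n], by simp; linarith [hq1.2.2, hτ1 n]⟩
    rw [map_add, map_smul] at this
    convert this using 1
    abel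
  have hind : ∀ (A : Set Plane) (hA : MeasurableSet A), ∫⁻ x in A, ∫⁻ y in A, ‖u x - u y‖ₑ ^ 2
      = ∫⁻ x, ∫⁻ y, (A ×ˢ A).indicator (fun z => ‖u z.1 - u z.2‖ₑ ^ 2) (x, y) := by
    intro A hA
    rw [← lintegral_indicator hA]
    refine lintegral_congr fun x => ?_
    by_cases hx : x ∈ A
    · rw [Set.indicator_of_mem hx, ← lintegral_indicator hA]
      refine lintegral_congr fun y => ?_
      by_cases hy : y ∈ A <;> simp [hx, hy]
    · simp [hx]
  have hmeas : Measurable fun z : Plane × Plane => ‖u z.1 - u z.2‖ₑ ^ 2 :=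
    ((hum.comp measurable_fst).sub (hum.comp measurable_snd)).enorm.pow_const 2
  rw [hind _ (hopen p).measurableSet]
  have hfin := lintegral_lintegral_le_of_le_liminf (μ := (volume : Measure Plane))
    (F := fun x y => (((fun q => p + T q) '' S) ×ˢ ((fun q => p + T q) '' S)).indicator
      (fun z => ‖u z.1 - u z.2‖ₑ ^ 2) (x, y))
    (G := fun n x y => (V n ×ˢ V n).indicator (fun z => ‖u z.1 - u z.2‖ₑ ^ 2) (x, y))
    (C := 4 * (‖T (1, 0)‖ₑ + ‖T (0, 1)‖ₑ) ^ 2 * totalVariation Ω u ^ 2)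
    (fun n => hmeas.indicator ((hopen _).measurableSet.prod (hopen _).measurableSet)) ?_
    (Eventually.of_forall fun n => by
      rw [← hind _ (hopen _).measurableSet]; exact hbound n)
  · exact hfin
  · refine Eventually.of_forall fun x => Eventually.of_forall fun y => ?_
    have hev : ∀ x ∈ (fun q => p + T q) '' S, ∀ᶠ n in atTop, x ∈ V n := by
      intro x hx
      have hlim : Tendsto (fun n => x - τ n • T (1, 1)) atTop (𝓝 x) := by
        simpa using tendsto_const_nhds.sub (hτ0.smul_const (T (1, 1)))
      filter_upwards [hlim.eventually ((hopen p).mem_nhds hx)] with n hn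
      obtain ⟨q, hq, hqx⟩ := hn
      refine ⟨q, hq, ?_⟩
      simp only at hqx ⊢
      rw [add_right_comm, hqx, sub_add_cancel]
    by_cases hxy : (x, y) ∈ ((fun q => p + T q) '' S) ×ˢ ((fun q => p + T q) '' S)
    · rw [Set.indicator_of_mem hxy]
      refine le_liminf_of_le (by isBoundedDefault) ?_
      filter_upwards [hev x hxy.1, hev y hxy.2] with n h1 h2
      rw [Set.indicator_of_mem (Set.mk_mem_prod h1 h2)]
    · rw [Set.indicator_of_notMem hxy]
      exact zero_le

/-! ### Corner charts of Lipschitz domains -/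

/-- The linear coordinates `(s, t)` along the directions `(κ, κ M)` and `(-κ, κ M)`. -/
noncomputable def skewEquiv {κ M : ℝ} (hκ : κ ≠ 0) (hM : M ≠ 0) : (ℝ × ℝ) ≃L[ℝ] Plane :=
  LinearEquiv.toContinuousLinearEquiv
    { toFun := fun q => !₂[κ * (q.1 - q.2), κ * M * (q.1 + q.2)]
      invFun := fun x => ((x 0 / κ + x 1 / (κ * M)) / 2, (x 1 / (κ * M) - x 0 / κ) / 2)
      map_add' := fun q q' => by ext i; fin_cases i <;> simp <;> ring
      map_smul' := fun c q => by ext i; fin_cases i <;> simp <;> ring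
      left_inv := fun q => by ext <;> simp <;> field_simp <;> ring
      right_inv := fun x => by ext i; fin_cases i <;> simp <;> field_simp <;> ring }

/-- If `Ω` is the set of points above a Lipschitz graph near `p`, and `p` lies on or above the
graph, then two directions which are steeper than the graph give a corner chart containing `p`. -/
lemma exists_isCornerChart_of_graph {Ω : Set Plane} {p : Plane} {e : Plane ≃ₗᵢ[ℝ] Plane}
    {γ : ℝ → ℝ} {L : ℝ≥0} {r : ℝ} (hγ : LipschitzWith L γ) (hr : 0 < r)
    (hΩ : ∀ x ∈ Metric.ball p r, x ∈ Ω ↔ γ (e x 0) < e x 1) (hp : γ (e p 0) ≤ e p 1) :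
    ∃ (p₀ : Plane) (T : (ℝ × ℝ) ≃L[ℝ] Plane), IsCornerChart Ω p₀ T ∧
      p ∈ (fun q => p₀ + T q) '' (Set.Ioo (0 : ℝ) 1 ×ˢ Set.Ioo (0 : ℝ) 1) := by
  set M : ℝ := 2 * L + 2 with hM
  have hL : (0 : ℝ) ≤ L := L.2
  have hMpos : 0 < M := by positivity
  -- the factor `κ` makes the image of the square `(0, 2)²` fit into the ball
  set κ : ℝ := r / (5 + 4 * M) with hκ
  have hκpos : 0 < κ := by positivity
  have hκr : κ * (4 + 4 * M) < r := by
    rw [hκ, div_mul_eq_mul_div, div_lt_iff₀ (by positivity)]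
    nlinarith
  set T := (skewEquiv hκpos.ne' hMpos.ne').trans e.symm.toContinuousLinearEquiv with hT
  have hTq : ∀ q, T q = e.symm (!₂[κ * (q.1 - q.2), κ * M * (q.1 + q.2)]) := fun q => rfl
  set p₀ := p - T (1 / 8, 1 / 8) with hp₀
  have hx : ∀ q, p₀ + T q = p + T (q - (1 / 8, 1 / 8)) := fun q => by
    rw [map_sub, hp₀]; abel
  have h0 : ∀ s t, e (p₀ + T (s, t)) 0 = e p 0 + κ * (s - t) := fun s t => by
    rw [hx, map_add, hTq, LinearIsometryEquiv.apply_symm_apply]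
    simp
  have h1 : ∀ s t, e (p₀ + T (s, t)) 1 = e p 1 + κ * M * (s + t - 1 / 4) := fun s t => by
    rw [hx, map_add, hTq, LinearIsometryEquiv.apply_symm_apply]
    change e p 1 + κ * M * ((s - 1 / 8) + (t - 1 / 8)) = _
    ring
  have hball : ∀ s t, s ∈ Set.Ioo (0 : ℝ) 2 → t ∈ Set.Ioo (0 : ℝ) 2 →
      p₀ + T (s, t) ∈ Metric.ball p r := by
    intro s t hs ht
    rw [hx, mem_ball_iff_norm, add_sub_cancel_left, hTq, LinearIsometryEquiv.norm_map,
      EuclideanSpace.norm_eq, Real.sqrt_lt' hr]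
    simp only [Fin.sum_univ_two, Real.norm_eq_abs, sq_abs]
    have a1 : |κ * (s - 1 / 8 - (t - 1 / 8))| ≤ κ * 4 := by
      rw [abs_mul, abs_of_pos hκpos]
      gcongr
      rw [abs_le]; constructor <;> linarith [hs.1, hs.2, ht.1, ht.2]
    have a2 : |κ * M * (s - 1 / 8 + (t - 1 / 8))| ≤ κ * M * 4 := by
      rw [abs_mul, abs_of_pos (mul_pos hκpos hMpos)]
      gcongr
      rw [abs_le]; constructor <;> linarith [hs.1, hs.2, ht.1, ht.2]
    have s1 := sq_le_sq' (abs_le.1 a1).1 (abs_le.1 a1).2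
    have s2 := sq_le_sq' (abs_le.1 a2).1 (abs_le.1 a2).2
    have hpos : 0 < κ * (4 + 4 * M) := by positivity
    have := mul_pos (mul_pos hκpos hκpos) hMpos
    have hr2 : (κ * (4 + 4 * M)) ^ 2 < r ^ 2 := pow_lt_pow_left₀ hκr hpos.le two_ne_zero
    simp at s1 s2 ⊢
    nlinarith
  have hmem : ∀ s t, s ∈ Set.Ioo (0 : ℝ) 2 → t ∈ Set.Ioo (0 : ℝ) 2 →
      (p₀ + T (s, t) ∈ Ω ↔
        γ (e p 0 + κ * (s - t)) < e p 1 + κ * M * (s + t - 1 / 4)) := by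
    intro s t hs ht
    rw [hΩ _ (hball s t hs ht), h0, h1]
  have hlip : ∀ a b, γ a ≤ γ b + L * |a - b| := fun a b => by
    have := hγ.dist_le_mul a b
    rw [Real.dist_eq, Real.dist_eq] at this
    linarith [(abs_le.1 this).2]
  have hstrip : ∀ s t, s ∈ Set.Ioo (0 : ℝ) 1 → t ∈ Set.Ioo (0 : ℝ) 1 → 1 / 2 < s + t →
      p₀ + T (s, t) ∈ Ω := by
    intro s t hs ht hst
    rw [hmem s t ⟨hs.1, by linarith [hs.2]⟩ ⟨ht.1, by linarith [ht.2]⟩]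
    have h2 := hlip (e p 0 + κ * (s - t)) (e p 0)
    rw [add_sub_cancel_left, abs_mul, abs_of_pos hκpos] at h2
    have h3 : |s - t| ≤ s + t := by rw [abs_le]; constructor <;> linarith [hs.1, ht.1]
    have h4 : L * (κ * |s - t|) ≤ L * (κ * (s + t)) := by gcongr
    have h5 : L * (s + t) < M * (s + t - 1 / 4) := by rw [hM]; nlinarith
    have h6 := mul_lt_mul_of_pos_left h5 hκpos
    linarith
  refine ⟨p₀, T, ⟨?_, ?_, ?_⟩, ⟨(1 / 8, 1 / 8), by norm_num, by simp [hp₀]⟩⟩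
  · rintro ⟨s, t⟩ ⟨s', t'⟩ ⟨hs, ht⟩ hq ⟨hss, htt⟩ ⟨hs', ht'⟩
    simp only [Set.mem_Iio, Set.mem_Ioo] at hs ht hss htt hs' ht'
    rw [hmem s t ⟨hs.1, by linarith⟩ ⟨ht.1, by linarith⟩] at hq
    rw [hmem s' t' ⟨by linarith, hs'⟩ ⟨by linarith, ht'⟩]
    have h2 := hlip (e p 0 + κ * (s' - t')) (e p 0 + κ * (s - t))
    rw [add_sub_add_left_eq_sub, ← mul_sub, abs_mul, abs_of_pos hκpos] at h2
    have h3 : |s' - t' - (s - t)| ≤ (s' - s) + (t' - t) := by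
      rw [abs_le]; constructor <;> linarith
    have h4 : L * (κ * |s' - t' - (s - t)|) ≤ L * (κ * ((s' - s) + (t' - t))) := by gcongr
    have h5 : L * ((s' - s) + (t' - t)) ≤ M * ((s' - s) + (t' - t)) := by
      rw [hM]; nlinarith
    have h6 := mul_le_mul_of_nonneg_left h5 hκpos.le
    linarith
  · intro s t hs ht
    exact hstrip s t ⟨by linarith [hs.1], hs.2⟩ ht (by linarith [hs.1, ht.1])
  · intro s t hs ht
    exact hstrip s t hs ⟨by linarith [ht.1], ht.2⟩ (by linarith [hs.1, ht.1])

lemma HasLipschitzBoundary.exists_isCornerChart {Ω : Set Plane} (hΩ : IsOpen Ω)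
    (hL : HasLipschitzBoundary Ω) {p : Plane} (hp : p ∈ closure Ω) :
    ∃ (p₀ : Plane) (T : (ℝ × ℝ) ≃L[ℝ] Plane), IsCornerChart Ω p₀ T ∧
      p ∈ (fun q => p₀ + T q) '' (Set.Ioo (0 : ℝ) 1 ×ˢ Set.Ioo (0 : ℝ) 1) := by
  by_cases hpΩ : p ∈ Ω
  · -- near an interior point, `Ω` lies above a horizontal line below a ball contained in `Ω`
    obtain ⟨r, hr, hball⟩ := Metric.isOpen_iff.1 hΩ p hpΩ
    refine exists_isCornerChart_of_graph (e := LinearIsometryEquiv.refl ℝ Plane)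
      (γ := fun _ => p 1 - r) (L := 0) (LipschitzWith.const _) hr (fun x hx => ?_) ?_
    · refine iff_of_true (hball hx) ?_
      have h1 := PiLp.norm_apply_le (x - p) 1
      rw [mem_ball_iff_norm] at hx
      rw [PiLp.sub_apply, Real.norm_eq_abs] at h1
      have := (abs_lt.1 (h1.trans_lt hx)).1
      simp
      linarith
    · simp [hr.le]
  · obtain ⟨e, γ, L, r, hγ, hr, h⟩ := hL p (by rw [hΩ.frontier_eq]; exact ⟨hp, hpΩ⟩)
    refine exists_isCornerChart_of_graph hγ hr h ?_
    refine (mem_closure_iff_seq_limit.1 hp).elim fun x hx => ?_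
    have hc0 : Continuous fun x => γ (e x 0) := hγ.continuous.comp
      ((PiLp.continuous_apply 2 _ 0).comp e.continuous)
    have hc1 : Continuous fun x => e x 1 := (PiLp.continuous_apply 2 _ 1).comp e.continuous
    refine le_of_tendsto_of_tendsto ((hc0.tendsto p).comp hx.2) ((hc1.tendsto p).comp hx.2) ?_
    filter_upwards [hx.2.eventually (Metric.ball_mem_nhds p hr)] with n hn
    exact ((h _ hn).1 (hx.1 n)).le

/-! ### From local to global Poincaré inequalities -/

lemma HasPoincare.mono {Ω V V' : Set Plane} (h : HasPoincare Ω V') (hV : V ⊆ V') :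
    HasPoincare Ω V := by
  obtain ⟨C, hC, h⟩ := h
  exact ⟨C, hC, fun u hum hu => ((lintegral_mono_set hV).trans
    (lintegral_mono fun x => lintegral_mono_set hV)).trans (h u hum hu)⟩

/-- The mixed term in the Poincaré inequality on a union: points of `V₁` and of `V₂` are compared
with all the points of the intersection. -/
lemma lintegral_sub_sq_mul_measure_inter_le {V₁ V₂ : Set Plane} {u : Plane → ℝ}
    (hu : Measurable u) :
    (∫⁻ x in V₁, ∫⁻ y in V₂, ‖u x - u y‖ₑ ^ 2) * volume (V₁ ∩ V₂)
      ≤ 2 * volume V₂ * (∫⁻ x in V₁, ∫⁻ y in V₁, ‖u x - u y‖ₑ ^ 2)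
        + 2 * volume V₁ * ∫⁻ x in V₂, ∫⁻ y in V₂, ‖u x - u y‖ₑ ^ 2 := by
  set k : Plane → Plane → ℝ≥0∞ := fun x y => ‖u x - u y‖ₑ ^ 2 with hk
  have hkm : Measurable (Function.uncurry k) :=
    ((hu.comp measurable_fst).sub (hu.comp measurable_snd)).enorm.pow_const 2
  have hkx : ∀ x, Measurable (k x) := fun x => hkm.comp measurable_prodMk_left
  have hki : ∀ A : Set Plane, Measurable fun x => ∫⁻ y in A, k x y := fun A =>
    hkm.lintegral_prod_right
  have htri : ∀ x y w, k x y ≤ 2 * k x w + 2 * k y w := by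
    intro x y w
    have h1 : ‖u x - u y‖ₑ ≤ ‖u x - u w‖ₑ + ‖u y - u w‖ₑ := by
      rw [enorm_sub_rev (u y)]
      calc ‖u x - u y‖ₑ = ‖(u x - u w) + (u w - u y)‖ₑ := by rw [sub_add_sub_cancel]
        _ ≤ _ := enorm_add_le _ _
    calc k x y ≤ (‖u x - u w‖ₑ + ‖u y - u w‖ₑ) ^ 2 := pow_le_pow_left' h1 2
      _ ≤ 2 * k x w + 2 * k y w := by
        have := ENNReal.rpow_add_le_mul_rpow_add_rpow ‖u x - u w‖ₑ ‖u y - u w‖ₑ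
          (p := 2) one_le_two
        norm_num at this
        rwa [mul_add] at this
  have hW : ∀ x y, k x y * volume (V₁ ∩ V₂)
      ≤ 2 * (∫⁻ w in V₁, k x w) + 2 * ∫⁻ w in V₂, k y w := by
    intro x y
    calc k x y * volume (V₁ ∩ V₂) = ∫⁻ _ in V₁ ∩ V₂, k x y := by simp
      _ ≤ ∫⁻ w in V₁ ∩ V₂, (2 * k x w + 2 * k y w) := lintegral_mono fun w => htri x y w
      _ = 2 * (∫⁻ w in V₁ ∩ V₂, k x w) + 2 * ∫⁻ w in V₁ ∩ V₂, k y w := by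
        rw [lintegral_add_left ((hkx x).const_mul 2), lintegral_const_mul _ (hkx x),
          lintegral_const_mul _ (hkx y)]
      _ ≤ _ := by
        gcongr
        · exact Set.inter_subset_left
        · exact Set.inter_subset_right
  calc (∫⁻ x in V₁, ∫⁻ y in V₂, k x y) * volume (V₁ ∩ V₂)
      = ∫⁻ x in V₁, ∫⁻ y in V₂, k x y * volume (V₁ ∩ V₂) := by
        rw [← lintegral_mul_const _ (hki V₂)]
        refine lintegral_congr fun x => ?_
        rw [← lintegral_mul_const _ (hkx x)]
    _ ≤ ∫⁻ x in V₁, ∫⁻ y in V₂, (2 * (∫⁻ w in V₁, k x w) + 2 * ∫⁻ w in V₂, k y w) :=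
        lintegral_mono fun x => lintegral_mono fun y => hW x y
    _ = ∫⁻ x in V₁, (2 * (∫⁻ w in V₁, k x w) * volume V₂
          + 2 * ∫⁻ y in V₂, ∫⁻ w in V₂, k y w) := by
        refine lintegral_congr fun x => ?_
        rw [lintegral_add_left measurable_const, lintegral_const, Measure.restrict_apply_univ,
          lintegral_const_mul _ (hki V₂)]
    _ = _ := by
        rw [lintegral_add_right _ measurable_const, lintegral_const, Measure.restrict_apply_univ,
          lintegral_mul_const _ ((hki V₁).const_mul 2), lintegral_const_mul _ (hki V₁)]
        ring

lemma HasPoincare.union {Ω V₁ V₂ : Set Plane} (h₁ : HasPoincare Ω V₁) (h₂ : HasPoincare Ω V₂)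
    (hV₁ : volume V₁ ≠ ⊤) (hV₂ : volume V₂ ≠ ⊤) (hV : volume (V₁ ∩ V₂) ≠ 0) :
    HasPoincare Ω (V₁ ∪ V₂) := by
  obtain ⟨C₁, hC₁, h₁⟩ := h₁
  obtain ⟨C₂, hC₂, h₂⟩ := h₂
  have hW : volume (V₁ ∩ V₂) ≠ ⊤ := measure_ne_top_of_subset Set.inter_subset_left hV₁
  set c := (2 * volume V₂ * C₁ + 2 * volume V₁ * C₂) / volume (V₁ ∩ V₂) with hc
  set c' := (2 * volume V₁ * C₂ + 2 * volume V₂ * C₁) / volume (V₁ ∩ V₂) with hc'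
  refine ⟨(C₁ + c) + (c' + C₂), ?_, fun u hum hu => ?_⟩
  · have : c ≠ ⊤ := ENNReal.div_ne_top (by finiteness) hV
    have : c' ≠ ⊤ := ENNReal.div_ne_top (by finiteness) hV
    finiteness
  have b1 := h₁ u hum hu
  have b2 := h₂ u hum hu
  set E := totalVariation Ω u ^ 2
  set k : Plane → Plane → ℝ≥0∞ := fun x y => ‖u x - u y‖ₑ ^ 2 with hk
  have hkm : Measurable (Function.uncurry k) :=
    ((hum.comp measurable_fst).sub (hum.comp measurable_snd)).enorm.pow_const 2
  have b12 : ∫⁻ x in V₁, ∫⁻ y in V₂, k x y ≤ c * E := by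
    rw [hc, ENNReal.mul_comm_div, ← mul_div_assoc, mul_comm,
      ENNReal.le_div_iff_mul_le (.inl hV) (.inl hW), mul_comm E]
    refine (lintegral_sub_sq_mul_measure_inter_le hum).trans ?_
    rw [add_mul, mul_assoc _ C₁, mul_assoc _ C₂]
    gcongr
  have b21 : ∫⁻ x in V₂, ∫⁻ y in V₁, k x y ≤ c' * E := by
    rw [hc', ENNReal.mul_comm_div, ← mul_div_assoc, mul_comm,
      ENNReal.le_div_iff_mul_le (.inl hV) (.inl hW), mul_comm E,
      Set.inter_comm V₁ V₂]
    refine (lintegral_sub_sq_mul_measure_inter_le hum).trans ?_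
    rw [add_mul, mul_assoc _ C₁, mul_assoc _ C₂]
    gcongr
  have hsplit : ∀ A : Set Plane, ∫⁻ x in A, ∫⁻ y in V₁ ∪ V₂, k x y
      ≤ (∫⁻ x in A, ∫⁻ y in V₁, k x y) + ∫⁻ x in A, ∫⁻ y in V₂, k x y := by
    intro A
    have hm : Measurable fun x => ∫⁻ y in V₁, k x y := hkm.lintegral_prod_right
    rw [← lintegral_add_left hm]
    exact lintegral_mono fun x => lintegral_union_le _ _ _
  calc ∫⁻ x in V₁ ∪ V₂, ∫⁻ y in V₁ ∪ V₂, k x y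
      ≤ (∫⁻ x in V₁, ∫⁻ y in V₁ ∪ V₂, k x y) + ∫⁻ x in V₂, ∫⁻ y in V₁ ∪ V₂, k x y :=
        lintegral_union_le _ _ _
    _ ≤ (C₁ * E + c * E) + (c' * E + C₂ * E) :=
        add_le_add ((hsplit V₁).trans (add_le_add b1 b12)) ((hsplit V₂).trans (add_le_add b21 b2))
    _ = _ := by ring

/-- The Poincaré inequality passes from the members of a finite open cover to a connected set. A
largest union of members of the cover with this property exhausts the set, as it would otherwise
meet another member. -/
lemma HasPoincare.of_finset_cover {Ω : Set Plane} (hΩc : IsConnected Ω) (hΩv : volume Ω ≠ ⊤)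
    {ι : Type*} (t : Finset ι) (V : ι → Set Plane) (hVo : ∀ i, IsOpen (V i))
    (hVΩ : ∀ i, V i ⊆ Ω) (hcov : Ω ⊆ ⋃ i ∈ t, V i) (hV : ∀ i, HasPoincare Ω (V i)) :
    HasPoincare Ω Ω := by
  classical
  obtain ⟨x₀, hx₀⟩ := hΩc.nonempty
  obtain ⟨i₀, hi₀, hxi₀⟩ := Set.mem_iUnion₂.1 (hcov hx₀)
  set 𝒮 := t.powerset.filter fun s => i₀ ∈ s ∧ HasPoincare Ω (⋃ i ∈ s, V i)
  have hne : 𝒮.Nonempty := ⟨{i₀}, by simp [𝒮, hi₀, hV i₀]⟩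
  obtain ⟨s, hs, hmax⟩ := Finset.exists_max_image 𝒮 Finset.card hne
  obtain ⟨hst, hi₀s, hsP⟩ : s ⊆ t ∧ i₀ ∈ s ∧ HasPoincare Ω (⋃ i ∈ s, V i) := by
    simpa [𝒮] using hs
  set A := ⋃ i ∈ s, V i with hA
  have hAo : IsOpen A := isOpen_biUnion fun i _ => hVo i
  have hAΩ : A ⊆ Ω := Set.iUnion₂_subset fun i _ => hVΩ i
  refine hsP.mono ?_
  by_contra hsub
  obtain ⟨z, hzΩ, hzA⟩ := Set.not_subset.1 hsub
  set D := ⋃ i ∈ t \ s, V i with hD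
  have hDo : IsOpen D := isOpen_biUnion fun i _ => hVo i
  have hAD : Ω ⊆ A ∪ D := by
    intro x hx
    obtain ⟨i, hi, hxi⟩ := Set.mem_iUnion₂.1 (hcov hx)
    by_cases his : i ∈ s
    · exact Or.inl (Set.mem_iUnion₂.2 ⟨i, his, hxi⟩)
    · exact Or.inr (Set.mem_iUnion₂.2 ⟨i, Finset.mem_sdiff.2 ⟨hi, his⟩, hxi⟩)
  obtain ⟨w, -, hwA, hwD⟩ := hΩc.isPreconnected A D hAo hDo hAD
    ⟨x₀, hx₀, Set.mem_iUnion₂.2 ⟨i₀, hi₀s, hxi₀⟩⟩ ⟨z, hzΩ, (hAD hzΩ).resolve_left hzA⟩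
  obtain ⟨j, hj, hwj⟩ := Set.mem_iUnion₂.1 hwD
  obtain ⟨hjt, hjs⟩ := Finset.mem_sdiff.1 hj
  have hins : HasPoincare Ω (⋃ i ∈ insert j s, V i) := by
    rw [Finset.set_biUnion_insert]
    exact (hV j).union hsP (measure_ne_top_of_subset (hVΩ j) hΩv)
      (measure_ne_top_of_subset hAΩ hΩv)
      (((hVo j).inter hAo).measure_pos volume ⟨w, hwj, hwA⟩).ne'
  have hcard := hmax (insert j s) (by
    simp only [𝒮, Finset.mem_filter, Finset.mem_powerset]
    exact ⟨Finset.insert_subset hjt hst, Finset.mem_insert_of_mem hi₀s, hins⟩)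
  rw [Finset.card_insert_of_notMem hjs] at hcard
  omega

lemma HasLipschitzBoundary.hasPoincare {Ω : Set Plane} (hΩo : IsOpen Ω) (hΩc : IsConnected Ω)
    (hΩb : Bornology.IsBounded Ω) (hΩL : HasLipschitzBoundary Ω) : HasPoincare Ω Ω := by
  have hcpt : IsCompact (closure Ω) := hΩb.isCompact_closure
  have hex : ∀ p : closure Ω, ∃ N : Set Plane, IsOpen N ∧ (p : Plane) ∈ N ∧
      HasPoincare Ω (Ω ∩ N) := by
    intro p
    obtain ⟨p₀, T, hT, hp⟩ := hΩL.exists_isCornerChart hΩo p.2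
    exact ⟨_, (T.toHomeomorph.trans (Homeomorph.addLeft p₀)).isOpenMap _
      (isOpen_Ioo.prod isOpen_Ioo), hp, hT.hasPoincare hΩo⟩
  choose N hNo hpN hNP using hex
  obtain ⟨t, ht⟩ := hcpt.elim_finite_subcover N hNo
    fun p hp => Set.mem_iUnion.2 ⟨⟨p, hp⟩, hpN ⟨p, hp⟩⟩
  refine HasPoincare.of_finset_cover hΩc hΩb.measure_lt_top.ne t (fun p => Ω ∩ N p)
    (fun p => hΩo.inter (hNo p)) (fun p => Set.inter_subset_left) ?_ hNP
  intro x hx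
  obtain ⟨p, hp, hxp⟩ := Set.mem_iUnion₂.1 (ht (subset_closure hx))
  exact Set.mem_iUnion₂.2 ⟨p, hp, hx, hxp⟩

/-! ### Boundedness, weak compactness and energy comparison -/

lemma HasPoincare.exists_enorm_sub_const_le {Ω : Set Plane} (hP : HasPoincare Ω Ω)
    (hΩ₀ : volume Ω ≠ 0) [IsFiniteMeasure (volume.restrict Ω : Measure Plane)] :
    ∃ C : ℝ≥0∞, C ≠ ⊤ ∧ ∀ u : L2 Ω, ∃ c : ℝ,
      ‖u - Lp.const 2 (volume.restrict Ω) c‖ₑ ^ 2 ≤ C * totalVariation Ω u ^ 2 := by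
  obtain ⟨C, hC, h⟩ := hP
  have hΩf : volume Ω ≠ ⊤ := by
    rw [← Measure.restrict_apply_univ]; exact measure_ne_top _ _
  refine ⟨C / volume Ω, ENNReal.div_ne_top hC hΩ₀, fun u => ?_⟩
  have hum : Measurable (u : Plane → ℝ) := (Lp.stronglyMeasurable u).measurable
  have hui : IntegrableOn (u : Plane → ℝ) Ω := (Lp.memLp u).integrable one_le_two
  have hkm : Measurable (Function.uncurry fun x y => ‖u x - u y‖ₑ ^ 2) :=
    ((hum.comp measurable_fst).sub (hum.comp measurable_snd)).enorm.pow_const 2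
  -- some value of `u` is at most as far from `u` as its values are on average
  obtain ⟨z, -, hz⟩ := exists_le_setLAverage hΩ₀ hΩf
    (f := fun x => ∫⁻ y in Ω, ‖u x - u y‖ₑ ^ 2) hkm.lintegral_prod_right.aemeasurable
  refine ⟨u z, ?_⟩
  have hnorm : ‖u - Lp.const 2 (volume.restrict Ω) (u z)‖ₑ ^ 2 = ∫⁻ y in Ω, ‖u z - u y‖ₑ ^ 2 := by
    have h2 := eLpNorm_nnreal_pow_eq_lintegral (μ := volume.restrict Ω) (p := 2)
      (f := fun y => u y - u z) two_ne_zero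
    have hcongr : eLpNorm (u - Lp.const 2 (volume.restrict Ω) (u z) : L2 Ω) 2 (volume.restrict Ω)
        = eLpNorm (fun y => u y - u z) 2 (volume.restrict Ω) := by
      refine eLpNorm_congr_ae ?_
      filter_upwards [Lp.coeFn_sub u (Lp.const 2 (volume.restrict Ω) (u z)),
        Lp.coeFn_const (p := 2) (volume.restrict Ω) (u z)] with y h1 h2
      rw [h1, Pi.sub_apply, h2, Function.const_apply]
    rw [Lp.enorm_def, hcongr]
    norm_num at h2
    rw [h2]
    exact lintegral_congr fun y => by rw [enorm_sub_rev]
  rw [hnorm]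
  refine hz.trans ?_
  rw [setLAverage_eq, ENNReal.mul_comm_div, mul_div_assoc']
  gcongr
  exact h u hum hui

/-- Functions whose total variation and whose images under `A` are bounded are bounded in `L²(Ω)`:
the distance to the constants is controlled by the total variation, and the constants by `A`. -/
lemma exists_norm_le_of_totalVariation_le {Y : Type*} [NormedAddCommGroup Y]
    [InnerProductSpace ℝ Y] {Ω : Set Plane} (hP : HasPoincare Ω Ω) (hΩ₀ : volume Ω ≠ 0)
    [IsFiniteMeasure (volume.restrict Ω : Measure Plane)] (A : L2 Ω →L[ℝ] Y)
    (hA : A (Lp.const 2 (volume.restrict Ω) 1) ≠ 0) (a : ℝ) {M : ℝ≥0∞} (hM : M ≠ ⊤) :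
    ∃ N : ℝ, ∀ u : L2 Ω, totalVariation Ω u ≤ M → ‖A u‖ ≤ a → ‖u‖ ≤ N := by
  obtain ⟨C, hC, h⟩ := hP.exists_enorm_sub_const_le hΩ₀
  set o : L2 Ω := Lp.const 2 (volume.restrict Ω) 1 with ho
  have hAo : 0 < ‖A o‖ := norm_pos_iff.2 hA
  set N₀ := √(C * M ^ 2).toReal with hN₀
  refine ⟨N₀ + (a + ‖A‖ * N₀) / ‖A o‖ * ‖o‖, fun u hu hAu => ?_⟩
  obtain ⟨c, hc⟩ := h u
  have hco : Lp.const 2 (volume.restrict Ω) c = c • o := by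
    have := (Lp.constₗ 2 (volume.restrict Ω : Measure Plane) ℝ (E := ℝ)).map_smul c 1
    rwa [smul_eq_mul, mul_one] at this
  rw [hco] at hc
  have h1 : ‖u - c • o‖ ≤ N₀ := by
    refine Real.le_sqrt_of_sq_le ?_
    have h2 : ‖u - c • o‖ₑ ^ 2 ≤ C * M ^ 2 := hc.trans (by gcongr)
    have h3 := ENNReal.toReal_mono (by finiteness) h2
    rwa [ENNReal.toReal_pow, toReal_enorm] at h3
  have h2 : |c| * ‖A o‖ ≤ a + ‖A‖ * N₀ := by
    calc |c| * ‖A o‖ = ‖A u - A (u - c • o)‖ := by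
          rw [← map_sub, sub_sub_cancel, map_smul, norm_smul, Real.norm_eq_abs]
      _ ≤ ‖A u‖ + ‖A (u - c • o)‖ := norm_sub_le _ _
      _ ≤ a + ‖A‖ * N₀ := add_le_add hAu ((A.le_opNorm _).trans (by gcongr))
  calc ‖u‖ = ‖(u - c • o) + c • o‖ := by rw [sub_add_cancel]
    _ ≤ ‖u - c • o‖ + |c| * ‖o‖ := (norm_add_le _ _).trans_eq (by
        rw [norm_smul, Real.norm_eq_abs])
    _ ≤ _ := by
        gcongr
        rwa [le_div_iff₀ hAo]

/-- Bounded sequences in a separable Hilbert space have weakly convergent subsequences. -/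
lemma exists_subseq_tendsto_weakSpace {H : Type*} [NormedAddCommGroup H] [InnerProductSpace ℝ H]
    [CompleteSpace H] [TopologicalSpace.SeparableSpace H] {x : ℕ → H} {N : ℝ}
    (hx : ∀ n, ‖x n‖ ≤ N) : ∃ (s : ℕ → ℕ) (u : H), StrictMono s ∧
      (∀ f : StrongDual ℝ H, Tendsto (fun n => f (x (s n))) atTop (𝓝 (f u))) ∧
      Tendsto (fun n => toWeakSpace ℝ H (x (s n))) atTop (𝓝 (toWeakSpace ℝ H u)) := by
  obtain ⟨F, -, s, hs, hF⟩ := WeakDual.isSeqCompact_closedBall ℝ H 0 N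
    (x := fun n => StrongDual.toWeakDual (InnerProductSpace.toDual ℝ H (x n))) (fun n => by
      simpa using hx n)
  set u := (InnerProductSpace.toDual ℝ H).symm (WeakDual.toStrongDual F) with hu
  have hconv : ∀ f : StrongDual ℝ H, Tendsto (fun n => f (x (s n))) atTop (𝓝 (f u)) := by
    intro f
    obtain ⟨y, rfl⟩ := (InnerProductSpace.toDual ℝ H).surjective f
    have h1 : Tendsto (fun n => inner ℝ (x (s n)) y) atTop (𝓝 (F y)) :=
      tendsto_iff_forall_eval_tendsto_topDualPairing.1 hF y
    have h2 : F y = inner ℝ u y := InnerProductSpace.toDual_symm_apply.symm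
    simp_rw [InnerProductSpace.toDual_apply_apply, real_inner_comm _ y]
    rwa [← h2]
  refine ⟨s, u, hs, hconv, ?_⟩
  have hind : IsInducing fun (z : WeakSpace ℝ H) (f : StrongDual ℝ H) =>
      (topDualPairing ℝ H).flip z f := ⟨rfl⟩
  exact hind.tendsto_nhds_iff.2 (tendsto_pi_nhds.2 hconv)

lemma IsMinimizer.energy_le {Y : Type*} [NormedAddCommGroup Y] [InnerProductSpace ℝ Y]
    {Ω : Set Plane} {m : ℕ} {W : Matrix (Fin 2) (Fin 2) ℝ → ℝ≥0∞} {ν : ℝ} {A : L2 Ω →L[ℝ] Y}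
    {R : L2 Ω} {α : ℝ} (hα : 0 ≤ α) {B B' : Y} {K : ℕ} [NeZero K] {I I' : Fin K → L2 Ω}
    {φ φ' : Fin K → Plane → Plane} (h : IsMinimizer Ω m W ν A R α α B' I φ)
    (hφ' : ∀ k, IsAdmissible m Ω (φ' k)) (hAB : A (I' 0) = B)
    (hfin : energy Ω m W ν A R 1 1 B I' φ' < ⊤) {δ : ℝ} (hδ : 0 ≤ δ) (hB : ‖B - B'‖ ^ 2 ≤ δ) :
    ENNReal.ofReal (1 / 2 * ‖A (I 0) - B'‖ ^ 2) + ENNReal.ofReal α * totalVariation Ω (I 0)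
      ≤ ENNReal.ofReal (1 / 2 * δ + α * (energy Ω m W ν A R 1 1 B I' φ').toReal) := by
  have hval : energy Ω m W ν A R 1 1 B I' φ'
      = totalVariation Ω (I' 0) + pathEnergy Ω m W ν R I' φ' := by
    simp [energy, dataEnergy, hAB]
  calc ENNReal.ofReal (1 / 2 * ‖A (I 0) - B'‖ ^ 2) + ENNReal.ofReal α * totalVariation Ω (I 0)
      ≤ energy Ω m W ν A R α α B' I φ := le_self_add
    _ ≤ energy Ω m W ν A R α α B' I' φ' := h.2 I' φ' hφ'
    _ = ENNReal.ofReal (1 / 2 * ‖B - B'‖ ^ 2)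
          + ENNReal.ofReal α * energy Ω m W ν A R 1 1 B I' φ' := by
        rw [hval, mul_add, ← add_assoc, energy, dataEnergy, hAB]
    _ ≤ ENNReal.ofReal (1 / 2 * δ) + ENNReal.ofReal α * energy Ω m W ν A R 1 1 B I' φ' := by
        gcongr
    _ = _ := by
        rw [ENNReal.ofReal_add (by positivity) (by positivity), ENNReal.ofReal_mul hα,
          ENNReal.ofReal_toReal hfin.ne]

end TDMInv

theorem theorem3p7
    {Y : Type*} [NormedAddCommGroup Y] [InnerProductSpace ℝ Y] [CompleteSpace Y]
    (Ω : Set TDMInv.Plane) (hΩo : IsOpen Ω) (hΩc : IsConnected Ω)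
    (hΩb : Bornology.IsBounded Ω) (hΩL : TDMInv.HasLipschitzBoundary Ω)
    (m : ℕ) (hm : 2 < m) (K : ℕ) [NeZero K]
    (W : Matrix (Fin 2) (Fin 2) ℝ → ℝ≥0∞) (hW : LowerSemicontinuous W)
    (ν : ℝ) (hν : 0 < ν)
    (A : TDMInv.L2 Ω →L[ℝ] Y)
    (hA : ∀ (u : TDMInv.L2 Ω) (c : ℝ), c ≠ 0 →
      (∀ᵐ x ∂(volume.restrict Ω), u x = c) → A u ≠ 0)
    (R : TDMInv.L2 Ω) (B : Y)
    (hB : ∃ (I : Fin K → TDMInv.L2 Ω) (φ : Fin K → TDMInv.Plane → TDMInv.Plane),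
      (∀ k, TDMInv.IsAdmissible m Ω (φ k)) ∧ A (I 0) = B ∧
        TDMInv.energy Ω m W ν A R 1 1 B I φ < ⊤)
    (α : ℝ → ℝ) (hαpos : ∀ δ, 0 < δ → 0 < α δ)
    (hα : Tendsto α (𝓝[>] 0) (𝓝 0))
    (hδα : Tendsto (fun δ => δ / α δ) (𝓝[>] 0) (𝓝 0))
    (δ : ℕ → ℝ) (hδpos : ∀ j, 0 < δ j) (hδ : Tendsto δ atTop (𝓝 0))
    (Bn : ℕ → Y) (hBn : ∀ j, ‖B - Bn j‖ ^ 2 ≤ δ j)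
    (I : ℕ → Fin K → TDMInv.L2 Ω) (φ : ℕ → Fin K → TDMInv.Plane → TDMInv.Plane)
    (hmin : ∀ j, TDMInv.IsMinimizer Ω m W ν A R (α (δ j)) (α (δ j)) (Bn j) (I j) (φ j)) :
    ∃ (s : ℕ → ℕ) (u : TDMInv.L2 Ω), StrictMono s ∧
      Tendsto (fun j => toWeakSpace ℝ (TDMInv.L2 Ω) (I (s j) 0)) atTop
        (𝓝 (toWeakSpace ℝ (TDMInv.L2 Ω) u)) ∧
      A u = B := by
  obtain ⟨I', φ', hφ', hAB, hfin⟩ := hB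
  set C := (TDMInv.energy Ω m W ν A R 1 1 B I' φ').toReal with hC
  have hC0 : 0 ≤ C := ENNReal.toReal_nonneg
  have hα0 : ∀ j, 0 < α (δ j) := fun j => hαpos _ (hδpos j)
  have hδ' : Tendsto δ atTop (𝓝[>] 0) :=
    tendsto_nhdsWithin_iff.2 ⟨hδ, Eventually.of_forall hδpos⟩
  have hαδ : Tendsto (fun j => α (δ j)) atTop (𝓝 0) := hα.comp hδ'
  have henergy := fun j =>
    (hmin j).energy_le (hα0 j).le hφ' hAB hfin (hδpos j).le (hBn j)
  have hdata : ∀ j, ‖A (I j 0) - Bn j‖ ^ 2 ≤ δ j + 2 * α (δ j) * C := by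
    intro j
    have hnn : 0 ≤ 1 / 2 * δ j + α (δ j) * C := by
      have := hδpos j
      have := hα0 j
      positivity
    have := (ENNReal.ofReal_le_ofReal_iff hnn).1 (le_self_add.trans (henergy j))
    linarith
  have hTV : ∀ j, TDMInv.totalVariation Ω (I j 0)
      ≤ ENNReal.ofReal (1 / 2 * (δ j / α (δ j)) + C) := by
    intro j
    have hpos : ENNReal.ofReal (α (δ j)) ≠ 0 := (ENNReal.ofReal_pos.2 (hα0 j)).ne'
    rw [← ENNReal.mul_le_mul_iff_right hpos ENNReal.ofReal_ne_top,
      ← ENNReal.ofReal_mul (hα0 j).le]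
    refine (le_add_self.trans (henergy j)).trans_eq ?_
    have := (hα0 j).ne'
    rw [← hC]
    congr 1
    field_simp
  -- the images `A (I j 0)` converge strongly to `B`
  have hsq : Tendsto (fun j => ‖A (I j 0) - Bn j‖) atTop (𝓝 0) := by
    have h1 : Tendsto (fun j => √(δ j + 2 * α (δ j) * C)) atTop (𝓝 0) := by
      have := (hδ.add ((hαδ.const_mul 2).mul_const C)).sqrt
      simpa using this
    exact squeeze_zero (fun _ => norm_nonneg _) (fun j => Real.le_sqrt_of_sq_le (hdata j)) h1
  have hsq' : Tendsto (fun j => ‖B - Bn j‖) atTop (𝓝 0) :=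
    squeeze_zero (fun _ => norm_nonneg _) (fun j => Real.le_sqrt_of_sq_le (hBn j))
      (by simpa using hδ.sqrt)
  have hAI : Tendsto (fun j => A (I j 0)) atTop (𝓝 B) := by
    rw [tendsto_iff_norm_sub_tendsto_zero]
    refine squeeze_zero (fun _ => norm_nonneg _) (fun j => ?_) (by simpa using hsq.add hsq')
    rw [← sub_sub_sub_cancel_right _ _ (Bn j)]
    exact norm_sub_le _ _
  -- hence the sequence is bounded in `L²(Ω)`
  have hfinite : IsFiniteMeasure (volume.restrict Ω : Measure TDMInv.Plane) :=
    isFiniteMeasure_restrict.2 hΩb.measure_lt_top.ne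
  have hΩ₀ : volume Ω ≠ 0 := (hΩo.measure_pos volume hΩc.nonempty).ne'
  have hA1 : A (Lp.const 2 (volume.restrict Ω) 1) ≠ 0 :=
    hA _ 1 one_ne_zero (Lp.coeFn_const (p := 2) (volume.restrict Ω) 1)
  obtain ⟨a, ha⟩ := hAI.norm.bddAbove_range
  obtain ⟨M, hM⟩ := (hδα.comp hδ').bddAbove_range
  obtain ⟨N, hN⟩ := TDMInv.exists_norm_le_of_totalVariation_le
    (hΩL.hasPoincare hΩo hΩc hΩb) hΩ₀ A hA1 a (M := ENNReal.ofReal (1 / 2 * M + C))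
    ENNReal.ofReal_ne_top
  have hbound : ∀ j, ‖I j 0‖ ≤ N := fun j =>
    hN _ ((hTV j).trans (ENNReal.ofReal_le_ofReal (by
      have : δ j / α (δ j) ≤ M := hM ⟨j, rfl⟩
      linarith))) (ha ⟨j, rfl⟩)
  have : Fact ((2 : ℝ≥0∞) ≠ ⊤) := ⟨ENNReal.ofNat_ne_top⟩
  obtain ⟨s, u, hs, hweak, hconv⟩ := TDMInv.exists_subseq_tendsto_weakSpace hbound
  refine ⟨s, u, hs, hconv, ext_inner_left ℝ fun y => ?_⟩
  exact tendsto_nhds_unique (hweak ((innerSL ℝ y).comp A))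
    (tendsto_const_nhds.inner (hAI.comp hs.tendsto_atTop))
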